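/- Let $W=\langle s_1,\dots,s_n \mid (s_is_j)^{m_{ij}}=1\rangle$ be a Weyl group, given by its Coxeter presentation ($m_{ii}=1$, and $m_{ij}=m_{ji}\in\{2,3,4,6\}$ for $i\neq j$; $W$ finite). Let $V$ be its complex reflection representation: it has a basis $\beta_1,\dots,\beta_n$ of normalized simple roots and a $W$-invariant symmetric bilinear form with $(\beta_i,\beta_j)=-\cos(\pi/m_{ij})$, and $s_i$ acts as the reflection $v\mapsto v-2(\beta_i,v)\beta_i$. Let $d_1,\dots,d_n$ be the degrees of $W$, that is, the degrees of algebraically independent homogeneous generators of the algebra of invariants $(S^*V)^W$, and let $(S^*V)_W=\bigoplus_k (S^kV)_W$ be the coinvariant algebra, the quotient of $S^*V$ by the ideal generated by the homogeneous invariants of positive degree. Let $\theta:\widetilde W\to W$ be the double cover of $W$ with generators $z,t_1,\dots,t_n$ and relations $z^2=1$, $z$ central, $(t_it_j)^{m_{ij}}=z^{m_{ij}+1}$, where $\theta(z)=1$ and $\theta(t_i)=s_i$. Let $\mathbb C W^-=\mathbb C\widetilde W/\langle z+1\rangle$ be the spin Weyl group algebra, a superalgebra in which every $t_i$ is odd.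 All modules are finite-dimensional and $\mathbb Z_2$-graded, simple means having no proper nonzero graded submodule, and $\mathrm{Hom}$ includes both even and odd homomorphisms. Let $\mathcal Cl_V$ be the Clifford algebra of $V$, normalized by $v^2=(v,v)$. The basic spin module $\mathcal B_W$ is a simple $\mathcal Cl_V$-module regarded as a $\mathbb C W^-$-module through the homomorphism $\mathbb C W^-\to \mathcal Cl_V$, $t_i\mapsto\beta_i$. For a simple $\mathbb C W^-$-module with character $\chi^-$, the spin fake degree is $$P_W^-(\chi^-,t)=\sum_{k\ge 0}\dim \mathrm{Hom}_{\mathbb C W^-}\bigl(\chi^-,\ \mathcal B_W\otimes (S^kV)_W\bigr)\,t^k ,$$ where $\tilde x\in\widetilde W$ acts on $\mathcal B_W\otimes (S^kV)_W$ by $\tilde x\otimes\theta(\tilde x)$ and $(S^kV)_W$ is purely even. A conjugacy class of $W$ is called even split if it contains $\theta(\tilde x)$ for some $\tilde x\in\widetilde W$ that is even (a product of an even number of the $t_i$ and of powers of $z$) and not conjugate to $z\tilde x$ in $\widetilde W$; write $W^{es}_*$ for the set of these classes, and $C_x$ for the centralizer of $x$ in $W$. Then, for every simple $\mathbb C W^-$-character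 $\chi^-$, as formal power series in $t$, $$P_W^-(\chi^-,t)=\Biggl(\sum_{\langle x\rangle\in W^{es}_*}\frac{\chi^-(\tilde x)\,\mathrm{tr}(\tilde x)|_{\mathcal B_W}}{|C_x|\,\det(1-tx)|_V}\Biggr)\prod_{i=1}^n\bigl(1-t^{d_i}\bigr),$$ where, for each class, $\tilde x\in\widetilde W$ is chosen arbitrarily such that $\theta(\tilde x)=x$ lies in that class. -/

import Mathlib

noncomputable section

namespace SpinWeyl

open scoped TensorProduct

/-! ### Super modules -/

/-- A `ℤ/2`-graded module `M = M₀ ⊕ M₁` over a complex superalgebra `A` with homogeneous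
parts `𝒜 0`, `𝒜 1`. -/
structure SuperModule {A : Type*} [Ring A] [Algebra ℂ A] (𝒜 : ZMod 2 → Submodule ℂ A)
    (M : Type*) [AddCommGroup M] [Module ℂ M] where
  /-- the action of `A` on `M` -/
  act : A →ₐ[ℂ] Module.End ℂ M
  /-- the homogeneous parts of `M` -/
  part : ZMod 2 → Submodule ℂ M
  isCompl : IsCompl (part 0) (part 1)
  act_mem : ∀ (p q : ZMod 2) (a : A) (m : M), a ∈ 𝒜 p → m ∈ part q → act a m ∈ part (p + q)

namespace SuperModule

variable {A B : Type*} [Ring A] [Algebra ℂ A] [Ring B] [Algebra ℂ B]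
  {𝒜 : ZMod 2 → Submodule ℂ A} {ℬ : ZMod 2 → Submodule ℂ B}
  {M N : Type*} [AddCommGroup M] [Module ℂ M] [AddCommGroup N] [Module ℂ N]

/-- A super module is simple if it is nonzero and has no graded submodules besides `0` and
itself. -/
def IsSimple (S : SuperModule 𝒜 M) : Prop :=
  Nontrivial M ∧ ∀ N : Submodule ℂ M, (∀ (a : A), ∀ m ∈ N, S.act a m ∈ N) →
    N = (N ⊓ S.part 0) ⊔ (N ⊓ S.part 1) → N = ⊥ ∨ N = ⊤

/-- The character: the trace of the action on the whole space `M₀ ⊕ M₁`. -/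
def character (S : SuperModule 𝒜 M) (a : A) : ℂ := LinearMap.trace ℂ M (S.act a)

/-- The homomorphisms of parity `p`: linear maps `f` that shift degrees by `p` and satisfy
`f (a m) = (-1)^(|f| |a|) a f(m)` for homogeneous `a`. -/
def homPart (S : SuperModule 𝒜 M) (T : SuperModule 𝒜 N) (p : ZMod 2) :
    Submodule ℂ (M →ₗ[ℂ] N) where
  carrier := {f | (∀ q, ∀ m ∈ S.part q, f m ∈ T.part (q + p)) ∧
    ∀ q, ∀ a ∈ 𝒜 q, ∀ m, f (S.act a m) = (-1 : ℂ) ^ (p * q).val • T.act a (f m)}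
  zero_mem' := by simp
  add_mem' := by
    rintro f g ⟨hf, hf'⟩ ⟨hg, hg'⟩
    refine ⟨fun q m hm => add_mem (hf q m hm) (hg q m hm), fun q a ha m => ?_⟩
    simp [hf' q a ha m, hg' q a ha m]
  smul_mem' := by
    rintro c f ⟨hf, hf'⟩
    refine ⟨fun q m hm => Submodule.smul_mem _ c (hf q m hm), fun q a ha m => ?_⟩
    simp [hf' q a ha m, smul_comm c]

/-- The space of all homomorphisms of super modules, `Hom = Hom₀ + Hom₁`. -/
def hom (S : SuperModule 𝒜 M) (T : SuperModule 𝒜 N) : Submodule ℂ (M →ₗ[ℂ] N) :=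
  S.homPart T 0 ⊔ S.homPart T 1

/-- Restriction along a homomorphism of superalgebras. -/
def pullback (f : A →ₐ[ℂ] B) (hf : ∀ p, ∀ a ∈ 𝒜 p, f a ∈ ℬ p) (S : SuperModule ℬ M) :
    SuperModule 𝒜 M where
  act := S.act.comp f
  part := S.part
  isCompl := S.isCompl
  act_mem p q a m ha hm := S.act_mem p q (f a) m (hf p a ha) hm

end SuperModule

/-- Tensoring with a fixed space preserves direct sum decompositions. -/
theorem isCompl_tensor {M N : Type*} [AddCommGroup M] [Module ℂ M] [AddCommGroup N] [Module ℂ N]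
    {P Q : Submodule ℂ M} (h : IsCompl P Q) :
    IsCompl (LinearMap.range (P.subtype.rTensor N)) (LinearMap.range (Q.subtype.rTensor N)) := by
  have hx : ∀ x ∈ LinearMap.range (P.subtype.rTensor N),
      (P.projection Q h).rTensor N x = x := by
    rintro _ ⟨y, rfl⟩
    rw [← LinearMap.rTensor_comp_apply]
    congr 2
    ext ⟨v, hv⟩
    simpa using hv
  have hy : ∀ x ∈ LinearMap.range (Q.subtype.rTensor N),
      (P.projection Q h).rTensor N x = 0 := by
    rintro _ ⟨y, rfl⟩
    rw [← LinearMap.rTensor_comp_apply]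
    have : (P.projection Q h) ∘ₗ Q.subtype = 0 := by
      ext ⟨v, hv⟩
      simpa using hv
    simp [this]
  constructor
  · rw [Submodule.disjoint_def]
    intro x h1 h2
    rw [← hx x h1, hy x h2]
  · rw [codisjoint_iff, eq_top_iff]
    rintro x -
    induction x using TensorProduct.induction_on with
    | zero => exact zero_mem _
    | add x y hx hy => exact add_mem hx hy
    | tmul m w =>
      have hm : m ∈ P ⊔ Q := by rw [h.sup_eq_top]; trivial
      obtain ⟨p, hp, q, hq, rfl⟩ := Submodule.mem_sup.1 hm
      rw [TensorProduct.add_tmul]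
      exact Submodule.add_mem_sup ⟨(⟨p, hp⟩ : P) ⊗ₜ w, by simp⟩ ⟨(⟨q, hq⟩ : Q) ⊗ₜ w, by simp⟩

/-! ### The reflection representation and its Clifford algebra -/

/-- The crystallographic restriction. The finite Coxeter groups that satisfy it are the Weyl
groups. -/
def IsCrystallographic {ι : Type*} (M : CoxeterMatrix ι) : Prop :=
  ∀ i j, i ≠ j → M i j ∈ ({2, 3, 4, 6} : Set ℕ)

section Reflection

variable {n : ℕ} (M : CoxeterMatrix (Fin n))

/-- The invariant form on `V = ℂⁿ`, in the basis `β₁, …, βₙ` of simple roots scaled to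
`(βᵢ, βᵢ) = 1`, so that `(βᵢ, βⱼ) = -cos (π / mᵢⱼ)`. -/
def form : LinearMap.BilinForm ℂ (Fin n → ℂ) :=
  Matrix.toBilin' (Matrix.of fun i j => -(Real.cos (Real.pi / M i j) : ℂ))

/-- The quadratic form `v ↦ (v, v)`. -/
def quadForm : QuadraticForm ℂ (Fin n → ℂ) := LinearMap.BilinMap.toQuadraticMap (form M)

/-- The simple root `βᵢ`. -/
def root (i : Fin n) : Fin n → ℂ := Pi.single i 1

/-- The simple reflection `v ↦ v - 2 (βᵢ, v) βᵢ`. -/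
def simpleReflection (i : Fin n) : Module.End ℂ (Fin n → ℂ) :=
  Module.preReflection (root i) ((2 : ℂ) • form M (root i))

/-- The Clifford algebra of `V`; thus `v * v = (v, v)` and `βᵢ * βᵢ = 1`. -/
abbrev Cl : Type := CliffordAlgebra (quadForm M)

/-- The generator `βᵢ` of the Clifford algebra. -/
def clRoot (i : Fin n) : Cl M := CliffordAlgebra.ι (quadForm M) (root i)

theorem form_root (i j : Fin n) :
    form M (root i) (root j) = -(Real.cos (Real.pi / M i j) : ℂ) := by
  simp [form, root]

theorem form_symm (v w : Fin n → ℂ) : form M v w = form M w v := by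
  have : (form M).IsSymm := by
    rw [form, Matrix.isSymm_toBilin'_iff_isSymm]
    ext i j
    simp [M.symmetric i j]
  exact this.eq v w

theorem ι_mul_ι (v w : Fin n → ℂ) :
    CliffordAlgebra.ι (quadForm M) v * CliffordAlgebra.ι (quadForm M) w +
      CliffordAlgebra.ι (quadForm M) w * CliffordAlgebra.ι (quadForm M) v =
      algebraMap ℂ (Cl M) (2 * form M v w) := by
  rw [CliffordAlgebra.ι_mul_ι_add_swap]
  congr 1
  simp [quadForm, LinearMap.BilinMap.polar_toQuadraticMap, form_symm M w v, two_mul]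

theorem clRoot_sq (i : Fin n) : clRoot M i * clRoot M i = 1 := by
  rw [clRoot, CliffordAlgebra.ι_sq_scalar]
  have : quadForm M (root i) = 1 := by simp [quadForm, form_root]
  rw [this, map_one]

theorem pow_eq_of_cos {A : Type*} [Ring A] [Algebra ℂ A] (a : A) (m : ℕ) (hm : 2 ≤ m)
    (ha : a * a = -(algebraMap ℂ A (2 * (Real.cos (Real.pi / m) : ℂ)) * a) - 1) :
    a ^ m = (-1) ^ (m + 1) := by
  set θ : ℂ := (Real.pi : ℂ) / m with hθ
  have hc : ((Real.cos (Real.pi / m) : ℝ) : ℂ) = Complex.cos θ := by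
    push_cast; rw [hθ]
  rw [hc] at ha
  have key : ∀ k : ℕ, Complex.sin θ • a ^ k =
      (-1 : ℂ) ^ (k + 1) • (Complex.sin (k * θ) • a + Complex.sin ((k - 1) * θ) • (1 : A)) := by
    intro k
    induction k with
    | zero => simp
    | succ k ih =>
      rw [pow_succ, ← smul_mul_assoc, ih, smul_mul_assoc, add_mul, smul_mul_assoc, ha]
      have h2 : Complex.sin (((k + 1 : ℕ) : ℂ) * θ) =
          2 * Complex.cos θ * Complex.sin (k * θ) - Complex.sin ((k - 1) * θ) := by
        push_cast
        rw [add_mul, sub_mul, one_mul, Complex.sin_add, Complex.sin_sub]; ring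
      rw [h2, ← Algebra.smul_def, smul_mul_assoc, one_mul]
      push_cast
      rw [add_sub_cancel_right, pow_succ (-1 : ℂ) (k + 1)]
      module
  have hm0 : (m : ℂ) ≠ 0 := by
    have : m ≠ 0 := by omega
    exact_mod_cast this
  have hs : Complex.sin θ ≠ 0 := by
    have h1 : Complex.sin θ = ((Real.sin (Real.pi / m) : ℝ) : ℂ) := by
      push_cast; rw [hθ]
    rw [h1, Complex.ofReal_ne_zero]
    apply ne_of_gt
    have hm' : (2 : ℝ) ≤ m := by exact_mod_cast hm
    apply Real.sin_pos_of_pos_of_lt_pi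
    · have := Real.pi_pos
      positivity
    · rw [div_lt_iff₀ (by linarith)]
      nlinarith [Real.pi_pos]
  have h := key m
  have e1 : (m : ℂ) * θ = Real.pi := by rw [hθ]; field_simp
  have e2 : ((m : ℂ) - 1) * θ = Real.pi - θ := by rw [sub_mul, e1, one_mul]
  rw [e1, e2, Complex.sin_pi, Complex.sin_pi_sub, zero_smul, zero_add, smul_comm] at h
  have h' := smul_right_injective A hs h
  simpa [Algebra.smul_def] using h'

theorem clRoot_pow (i j : Fin n) (h : M i j ≠ 0) :
    (clRoot M i * clRoot M j) ^ M i j = (-1) ^ (M i j + 1) := by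
  by_cases hij : i = j
  · subst hij
    simp [clRoot_sq]
  have h1 : M i j ≠ 1 := M.off_diagonal i j hij
  apply pow_eq_of_cos _ _ (by omega)
  have hs : clRoot M j * clRoot M i =
      -(algebraMap ℂ (Cl M) (2 * (Real.cos (Real.pi / M i j) : ℂ))) - clRoot M i * clRoot M j := by
    rw [eq_sub_iff_add_eq', clRoot, clRoot, ι_mul_ι, form_root]
    simp
  have hu : (clRoot M j * clRoot M i) * (clRoot M i * clRoot M j) = 1 := by
    rw [mul_assoc, ← mul_assoc (clRoot M i) (clRoot M i), clRoot_sq, one_mul, clRoot_sq]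
  rw [hs, sub_mul, neg_mul] at hu
  rw [← hu]; abel

theorem ι_simpleReflection (i : Fin n) (v : Fin n → ℂ) :
    CliffordAlgebra.ι (quadForm M) (simpleReflection M i v) =
      -(clRoot M i * CliffordAlgebra.ι (quadForm M) v * clRoot M i) := by
  have h := ι_mul_ι M (root i) v
  have h1 : CliffordAlgebra.ι (quadForm M) v * clRoot M i =
      algebraMap ℂ (Cl M) (2 * form M (root i) v) -
        clRoot M i * CliffordAlgebra.ι (quadForm M) v := by
    rw [← h, clRoot]; abel
  rw [mul_assoc, h1, mul_sub, ← mul_assoc, clRoot_sq, one_mul, ← Algebra.commutes,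
    ← Algebra.smul_def, simpleReflection, Module.preReflection_apply]
  simp [clRoot]

theorem ι_injective : Function.Injective (CliffordAlgebra.ι (quadForm M)) := by
  intro v w h
  have h' := congrArg (CliffordAlgebra.equivExterior (quadForm M)) h
  simpa [CliffordAlgebra.equivExterior] using h'

theorem simpleReflection_isLiftable : M.IsLiftable (simpleReflection M) := by
  intro i j
  by_cases h : M i j = 0
  · simp [h]
  have key : ∀ (k : ℕ) (v : Fin n → ℂ),
      CliffordAlgebra.ι (quadForm M) (((simpleReflection M i * simpleReflection M j) ^ k) v) =
      (clRoot M i * clRoot M j) ^ k * CliffordAlgebra.ι (quadForm M) v *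
        (clRoot M j * clRoot M i) ^ k := by
    intro k
    induction k with
    | zero => simp
    | succ k ih =>
      intro v
      rw [pow_succ', Module.End.mul_apply, Module.End.mul_apply, ι_simpleReflection,
        ι_simpleReflection, ih, pow_succ' (clRoot M i * clRoot M j),
        pow_succ (clRoot M j * clRoot M i)]
      noncomm_ring
  refine LinearMap.ext fun v => ι_injective M ?_
  rw [key, clRoot_pow M i j h, M.symmetric i j, clRoot_pow M j i (by rwa [M.symmetric])]
  rcases neg_one_pow_eq_or (Cl M) (M j i + 1) with h' | h' <;> simp [h']

variable {M}

/-- The reflection representation `V` of `W`, with `sᵢ` acting as the reflection in `βᵢ`. -/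
def reflectionRep {W : Type*} [Group W] (cs : CoxeterSystem M W) :
    Representation ℂ W (Fin n → ℂ) :=
  cs.lift ⟨simpleReflection M, simpleReflection_isLiftable M⟩

end Reflection

/-! ### Symmetric algebra, degrees and coinvariants -/

section Coinvariants

variable {G V : Type*} [Group G] [AddCommGroup V] [Module ℂ V] (ρ : Representation ℂ G V)

/-- The action of `G` on the symmetric algebra by algebra automorphisms. -/
def symAct (g : G) : SymmetricAlgebra ℂ V →ₐ[ℂ] SymmetricAlgebra ℂ V :=
  SymmetricAlgebra.lift (SymmetricAlgebra.ι ℂ V ∘ₗ ρ g)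

theorem symAct_one : symAct ρ 1 = AlgHom.id ℂ _ := by
  apply SymmetricAlgebra.algHom_ext
  ext v
  simp [symAct]

theorem symAct_mul (g h : G) : symAct ρ (g * h) = (symAct ρ g).comp (symAct ρ h) := by
  apply SymmetricAlgebra.algHom_ext
  ext v
  simp [symAct]

variable (V) in
/-- The `k`-th symmetric power `Sᵏ V`, the span of the `k`-fold products of vectors. -/
def symDeg (k : ℕ) : Submodule ℂ (SymmetricAlgebra ℂ V) :=
  LinearMap.range (SymmetricAlgebra.ι ℂ V) ^ k

/-- The algebra of invariants `(S^*V)^G`. -/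
def invariants : Subalgebra ℂ (SymmetricAlgebra ℂ V) where
  carrier := {f | ∀ g, symAct ρ g f = f}
  mul_mem' ha hb g := by rw [map_mul, ha g, hb g]
  add_mem' ha hb g := by rw [map_add, ha g, hb g]
  algebraMap_mem' c g := by simp

/-- `d₁, …, dₙ` are the degrees of the group: the degrees of algebraically independent
homogeneous generators of its algebra of invariants. -/
def IsDegrees {n : ℕ} (d : Fin n → ℕ) : Prop :=
  ∃ f : Fin n → SymmetricAlgebra ℂ V, (∀ i, f i ∈ symDeg V (d i)) ∧
    AlgebraicIndependent ℂ f ∧ Algebra.adjoin ℂ (Set.range f) = invariants ρ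

/-- The ideal generated by the homogeneous invariants of positive degree. -/
def coinvIdeal : Ideal (SymmetricAlgebra ℂ V) :=
  Ideal.span {f : SymmetricAlgebra ℂ V | f ∈ invariants ρ ∧ ∃ k, 0 < k ∧ f ∈ symDeg V k}

/-- The coinvariant algebra `(S^*V)_G`. -/
abbrev CoinvAlgebra : Type _ := SymmetricAlgebra ℂ V ⧸ coinvIdeal ρ

theorem coinvIdeal_le_comap (g : G) : coinvIdeal ρ ≤ (coinvIdeal ρ).comap (symAct ρ g) := by
  rw [coinvIdeal, Ideal.span_le]
  intro f hf
  change symAct ρ g f ∈ Ideal.span _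
  rw [hf.1 g]
  exact Ideal.subset_span hf

/-- The action of `G` on the coinvariant algebra. -/
def coinvAct (g : G) : CoinvAlgebra ρ →ₐ[ℂ] CoinvAlgebra ρ :=
  Ideal.quotientMapₐ (coinvIdeal ρ) (symAct ρ g) (coinvIdeal_le_comap ρ g)

/-- The graded piece `(SᵏV)_G` of the coinvariant algebra. -/
def coinvDeg (k : ℕ) : Submodule ℂ (CoinvAlgebra ρ) :=
  (symDeg V k).map (Ideal.Quotient.mkₐ ℂ (coinvIdeal ρ)).toLinearMap

theorem symAct_mem (g : G) (k : ℕ) (f : SymmetricAlgebra ℂ V) (hf : f ∈ symDeg V k) :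
    symAct ρ g f ∈ symDeg V k := by
  have h : (symDeg V k).map (symAct ρ g).toLinearMap ≤ symDeg V k := by
    rw [symDeg, Submodule.map_pow]
    refine pow_le_pow_left' ?_ k
    rintro _ ⟨_, ⟨v, rfl⟩, rfl⟩
    exact ⟨ρ g v, by simp [symAct]⟩
  exact h ⟨f, hf, rfl⟩

theorem coinvAct_mem (g : G) (k : ℕ) (f : CoinvAlgebra ρ) (hf : f ∈ coinvDeg ρ k) :
    coinvAct ρ g f ∈ coinvDeg ρ k := by
  obtain ⟨f, hf, rfl⟩ := hf
  exact ⟨symAct ρ g f, symAct_mem ρ g k f hf, rfl⟩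

/-- The representation of `G` on `(SᵏV)_G`. -/
def coinvRep (k : ℕ) : Representation ℂ G (coinvDeg ρ k) where
  toFun g := (coinvAct ρ g).toLinearMap.restrict (coinvAct_mem ρ g k)
  map_one' := by
    ext ⟨_, f, hf, rfl⟩
    change Ideal.Quotient.mk _ (symAct ρ 1 f) = Ideal.Quotient.mk _ f
    rw [symAct_one]; rfl
  map_mul' g h := by
    ext ⟨_, f, hf, rfl⟩
    change Ideal.Quotient.mk _ (symAct ρ (g * h) f) =
      Ideal.Quotient.mk _ (symAct ρ g (symAct ρ h f))
    rw [symAct_mul]; rfl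

end Coinvariants

/-! ### The double cover and the spin Weyl group algebra -/

section Spin

variable {n : ℕ} (M : CoxeterMatrix (Fin n))

/-- Relations of the double cover on the generators `z = none` and `tᵢ = some i`: `z` is central,
`z² = 1`, and `(tᵢ tⱼ)^mᵢⱼ = z^(mᵢⱼ + 1)`. (An entry `0` of a Coxeter matrix stands for `∞`,
that is, for no relation.) -/
def coverRels : Set (FreeGroup (Option (Fin n))) :=
  {FreeGroup.of none ^ 2} ∪
  {r | ∃ i, r = FreeGroup.of none * FreeGroup.of (some i) *
    (FreeGroup.of none)⁻¹ * (FreeGroup.of (some i))⁻¹} ∪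
  {r | ∃ i j, M i j ≠ 0 ∧ r = (FreeGroup.of (some i) * FreeGroup.of (some j)) ^ M i j *
    (FreeGroup.of none ^ (M i j + 1))⁻¹}

/-- The distinguished double cover `W̃` of `W`. -/
abbrev Cover : Type := PresentedGroup (coverRels M)

/-- The central element `z` of `W̃`. -/
def z : Cover M := PresentedGroup.of none

theorem rels_of {H : Type*} [Group H] (f : Option (Fin n) → H) (h1 : f none ^ 2 = 1)
    (h2 : ∀ i, f none * f (some i) = f (some i) * f none)
    (h3 : ∀ i j, M i j ≠ 0 → (f (some i) * f (some j)) ^ M i j = f none ^ (M i j + 1)) :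
    ∀ r ∈ coverRels M, FreeGroup.lift f r = 1 := by
  rintro r ((rfl | ⟨i, rfl⟩) | ⟨i, j, h, rfl⟩)
  · simpa using h1
  · simp [h2]
  · simp [h3 i j h]

/-- The homomorphism `W̃ → H` given by the images of the generators. -/
def Cover.lift {H : Type*} [Group H] (f : Option (Fin n) → H) (h1 : f none ^ 2 = 1)
    (h2 : ∀ i, f none * f (some i) = f (some i) * f none)
    (h3 : ∀ i j, M i j ≠ 0 → (f (some i) * f (some j)) ^ M i j = f none ^ (M i j + 1)) :
    Cover M →* H :=
  PresentedGroup.toGroup (rels_of M f h1 h2 h3)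

/-- The covering map `θ : W̃ → W`, `z ↦ 1`, `tᵢ ↦ sᵢ`. -/
def θ {M : CoxeterMatrix (Fin n)} {W : Type*} [Group W] (cs : CoxeterSystem M W) : Cover M →* W :=
  Cover.lift M (fun o => o.elim 1 cs.simple) (by simp) (by simp) (by simp)

/-- The parity `W̃ → ℤ/2` (written multiplicatively): `z` is even and every `tᵢ` is odd. -/
def parity : Cover M →* Multiplicative (ZMod 2) :=
  Cover.lift M (fun o => o.elim 1 fun _ => Multiplicative.ofAdd 1) (by simp) (by simp)
    (by
      intro i j _
      have : Multiplicative.ofAdd (1 : ZMod 2) * Multiplicative.ofAdd 1 = 1 := by decide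
      simp [this])

/-- The defining relation `z + 1 = 0`. -/
def spinRel (a b : MonoidAlgebra ℂ (Cover M)) : Prop :=
  a = MonoidAlgebra.of ℂ (Cover M) (z M) + 1 ∧ b = 0

/-- The spin Weyl group algebra `ℂW⁻ = ℂW̃ / ⟨z + 1⟩`. -/
abbrev SpinAlgebra : Type := RingQuot (spinRel M)

variable {M}

/-- The image of `x ∈ W̃` in `ℂW⁻`. -/
def toSpin (x : Cover M) : SpinAlgebra M :=
  RingQuot.mkAlgHom ℂ (spinRel M) (MonoidAlgebra.of ℂ (Cover M) x)

variable (M) in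
/-- The superalgebra structure of `ℂW⁻`: every `tᵢ` is odd. -/
def spinPart (p : ZMod 2) : Submodule ℂ (SpinAlgebra M) :=
  Submodule.span ℂ (toSpin '' {x | parity M x = Multiplicative.ofAdd p})

/-- A homomorphism on `W̃` sending `z` to `-1` factors through `ℂW⁻`. -/
def spinLift {A : Type*} [Ring A] [Algebra ℂ A] (f : Cover M →* A) (hz : f (z M) = -1) :
    SpinAlgebra M →ₐ[ℂ] A :=
  RingQuot.liftAlgHom ℂ ⟨MonoidAlgebra.lift ℂ A (Cover M) f, by
    rintro a b ⟨rfl, rfl⟩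
    simp [hz]⟩

theorem spinLift_toSpin {A : Type*} [Ring A] [Algebra ℂ A] (f : Cover M →* A) (hz : f (z M) = -1)
    (x : Cover M) : spinLift f hz (toSpin x) = f x := by
  simp [spinLift, toSpin]

theorem toSpin_z : toSpin (z M) = -1 := by
  have h : RingQuot.mkAlgHom ℂ (spinRel M) (MonoidAlgebra.of ℂ (Cover M) (z M) + 1) =
      RingQuot.mkAlgHom ℂ (spinRel M) 0 := RingQuot.mkAlgHom_rel ℂ ⟨rfl, rfl⟩
  rw [map_add, map_one, map_zero] at h
  exact eq_neg_of_add_eq_zero_left h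

/-- `x ↦ toSpin x` as a homomorphism. -/
def toSpinHom : Cover M →* SpinAlgebra M :=
  (RingQuot.mkAlgHom ℂ (spinRel M) : _ →* _).comp (MonoidAlgebra.of ℂ (Cover M))

variable (M) in
/-- The homomorphism from `W̃` to the units of the Clifford algebra, `z ↦ -1`, `tᵢ ↦ βᵢ`. -/
def coverToCl : Cover M →* (Cl M)ˣ :=
  Cover.lift M
    (fun o => o.elim (-1) fun i => ⟨clRoot M i, clRoot M i, clRoot_sq M i, clRoot_sq M i⟩)
    (by simp) (by simp)
    (by
      intro i j h
      ext
      simpa using clRoot_pow M i j h)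

variable (M) in
/-- The homomorphism of superalgebras `ℂW⁻ → Cl_V`, `tᵢ ↦ βᵢ`. -/
def spinToCl : SpinAlgebra M →ₐ[ℂ] Cl M :=
  spinLift ((Units.coeHom (Cl M)).comp (coverToCl M)) (by
    simp [coverToCl, Cover.lift, z, PresentedGroup.toGroup.of])

theorem coverToCl_mem (x : Cover M) :
    (coverToCl M x : Cl M) ∈
      CliffordAlgebra.evenOdd (quadForm M) (Multiplicative.toAdd (parity M x)) := by
  have hgen : ∀ o : Option (Fin n), ((coverToCl M (PresentedGroup.of o) : (Cl M)ˣ) : Cl M) ∈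
      CliffordAlgebra.evenOdd (quadForm M)
        (Multiplicative.toAdd (parity M (PresentedGroup.of o))) := by
    rintro (_ | i)
    · have h1 : coverToCl M (PresentedGroup.of none) = -1 := by
        simp [coverToCl, Cover.lift, PresentedGroup.toGroup.of]
      have h2 : parity M (PresentedGroup.of none) = 1 := by
        simp [parity, Cover.lift, PresentedGroup.toGroup.of]
      rw [h1, h2, Units.val_neg, Units.val_one]
      exact neg_mem (SetLike.GradedOne.one_mem (A := CliffordAlgebra.evenOdd (quadForm M)))
    · have h1 : (coverToCl M (PresentedGroup.of (some i)) : Cl M) = clRoot M i := by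
        simp [coverToCl, Cover.lift, PresentedGroup.toGroup.of]
      have h2 : parity M (PresentedGroup.of (some i)) = Multiplicative.ofAdd 1 := by
        simp [parity, Cover.lift, PresentedGroup.toGroup.of]
      rw [h1, h2]
      exact CliffordAlgebra.ι_mem_evenOdd_one _ _
  have hinv : ∀ o : Option (Fin n), (coverToCl M (PresentedGroup.of o))⁻¹ =
      coverToCl M (PresentedGroup.of o) := by
    rintro (_ | i)
    · simp [coverToCl, Cover.lift, PresentedGroup.toGroup.of]
    · rw [coverToCl, Cover.lift, PresentedGroup.toGroup.of]
      rfl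
  have hpar : ∀ p : Multiplicative (ZMod 2), p⁻¹ = p := by decide
  induction x using PresentedGroup.induction_on with
  | _ x =>
    induction x using FreeGroup.induction_on with
    | C1 =>
      simpa using (SetLike.GradedOne.one_mem (A := CliffordAlgebra.evenOdd (quadForm M)))
    | of o => exact hgen o
    | inv_of o _ =>
      rw [map_inv (PresentedGroup.mk _), map_inv (coverToCl M), map_inv (parity M), hpar]
      have := hinv o
      rw [PresentedGroup.of] at this
      rw [this]
      exact hgen o
    | mul x y hx hy =>
      rw [map_mul (PresentedGroup.mk _), map_mul (coverToCl M), map_mul (parity M), Units.val_mul, toAdd_mul]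
      exact SetLike.GradedMul.mul_mem hx hy

theorem spinToCl_mem (p : ZMod 2) (a : SpinAlgebra M) (ha : a ∈ spinPart M p) :
    spinToCl M a ∈ CliffordAlgebra.evenOdd (quadForm M) p := by
  induction ha using Submodule.span_induction with
  | mem x hx =>
    obtain ⟨x, hx, rfl⟩ := hx
    rw [spinToCl, spinLift_toSpin]
    have := coverToCl_mem x
    rw [show parity M x = Multiplicative.ofAdd p from hx] at this
    exact this
  | zero => simp
  | add x y _ _ hx hy => rw [map_add]; exact add_mem hx hy
  | smul c x _ hx => rw [map_smul]; exact Submodule.smul_mem _ _ hx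

/-- The basic spin module: a simple `Cl_V`-module `U`, restricted along `ℂW⁻ → Cl_V`. -/
def basicSpin {U : Type*} [AddCommGroup U] [Module ℂ U]
    (S : SuperModule (CliffordAlgebra.evenOdd (quadForm M)) U) : SuperModule (spinPart M) U :=
  S.pullback (spinToCl M) spinToCl_mem

/-- The tensor product of a `ℂW⁻`-module with a representation of `W`: the element
`x ∈ W̃` acts by `x ⊗ θ(x)`, and the representation of `W` is purely even. -/
def tensorRep {W : Type*} [Group W] (cs : CoxeterSystem M W)
    {E F : Type*} [AddCommGroup E] [Module ℂ E] [AddCommGroup F] [Module ℂ F]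
    (S : SuperModule (spinPart M) E) (τ : Representation ℂ W F) :
    SuperModule (spinPart M) (E ⊗[ℂ] F) where
  act := spinLift
    { toFun := fun x => TensorProduct.map (S.act (toSpin x)) (τ (θ cs x))
      map_one' := by
        rw [show toSpin (1 : Cover M) = 1 from map_one toSpinHom]
        simp
      map_mul' := fun x y => by
        rw [show toSpin (x * y) = toSpin x * toSpin y from map_mul toSpinHom x y]
        rw [map_mul, map_mul, map_mul]
        exact TensorProduct.map_mul _ _ _ _ }
    (by
      have : θ cs (z M) = 1 := by simp [θ, Cover.lift, z, PresentedGroup.toGroup.of]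
      ext
      simp [this, toSpin_z, TensorProduct.neg_tmul])
  part p := LinearMap.range ((S.part p).subtype.rTensor F)
  isCompl := isCompl_tensor S.isCompl
  act_mem := by
    intro p q a m ha hm
    obtain ⟨m, rfl⟩ := hm
    induction ha using Submodule.span_induction with
    | mem x hx =>
      obtain ⟨x, hx, rfl⟩ := hx
      rw [spinLift_toSpin]
      induction m using TensorProduct.induction_on with
      | zero => simp
      | add m m' h h' => rw [map_add, map_add]; exact add_mem h h'
      | tmul e f =>
        exact ⟨⟨S.act (toSpin x) e, S.act_mem p q _ _ (Submodule.subset_span ⟨x, hx, rfl⟩) e.2⟩ ⊗ₜ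
          τ (θ cs x) f, by simp⟩
    | zero => simp
    | add x y _ _ hx hy => rw [map_add, LinearMap.add_apply]; exact add_mem hx hy
    | smul c x _ hx => rw [map_smul, LinearMap.smul_apply]; exact Submodule.smul_mem _ _ hx

/-- The spin fake degree `P_W⁻(χ⁻, t) = ∑ₖ dim Hom (χ⁻, B_W ⊗ (SᵏV)_W) tᵏ`. -/
def spinFakeDegree {W : Type*} [Group W] (cs : CoxeterSystem M W)
    {U E : Type*} [AddCommGroup U] [Module ℂ U] [AddCommGroup E] [Module ℂ E]
    (S : SuperModule (CliffordAlgebra.evenOdd (quadForm M)) U) (χ : SuperModule (spinPart M) E) :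
    PowerSeries ℂ :=
  PowerSeries.mk fun k =>
    (Module.finrank ℂ (χ.hom (tensorRep cs (basicSpin S) (coinvRep (reflectionRep cs) k))) : ℂ)

/-- A class of `W` is even split if it has a preimage `x ∈ W̃` that is even and not
conjugate to `z x`. -/
def IsEvenSplit {W : Type*} [Group W] (cs : CoxeterSystem M W) (C : ConjClasses W) : Prop :=
  ∃ x : Cover M, ConjClasses.mk (θ cs x) = C ∧ parity M x = 1 ∧ ¬ IsConj x (z M * x)

/-- The power series `det (1 - t w)` for `w` acting on `V`. -/
def detOneSub {W : Type*} [Group W] (cs : CoxeterSystem M W) (w : W) : PowerSeries ℂ :=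
  ((LinearMap.toMatrix' (reflectionRep cs w)).charpolyRev : PowerSeries ℂ)

/-- The summand `χ⁻(x) tr(x)|_{B_W} / (|C_{θ(x)}| det (1 - t θ(x)))`. -/
def molienTerm {W : Type*} [Group W] (cs : CoxeterSystem M W)
    {U E : Type*} [AddCommGroup U] [Module ℂ U] [AddCommGroup E] [Module ℂ E]
    (S : SuperModule (CliffordAlgebra.evenOdd (quadForm M)) U) (χ : SuperModule (spinPart M) E)
    (x : Cover M) : PowerSeries ℂ :=
  PowerSeries.C (χ.character (toSpin x) * (basicSpin S).character (toSpin x)) *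
    ((Nat.card (Subgroup.centralizer {θ cs x}) : PowerSeries ℂ) * detOneSub cs (θ cs x))⁻¹

end Spin

end SpinWeyl

end

/-!
The formula is a Molien type computation. Two facts carry it.

**Characters.** Composing the odd part of a linear map with the parity involution turns
homomorphisms that obey the sign rule into plain intertwiners (`SuperModule.finrank_hom`), so the
dimension of `Hom` is given by orthogonality of characters of the finite group `W̃`
(`finrank_hom_eq_sum`, `finite_cover`). It is the average over `x ∈ W̃` of
`χ(x) tr(x⁻¹)|_B tr(θ(x)⁻¹)|_{(SᵏV)_W}`. Both inverses can be dropped. For `B`, a trace functional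
on a Clifford algebra that vanishes on odd elements is determined by its value at `1`, hence
invariant under the reversal, which induces `x ↦ x⁻¹` on `W̃` (`basicSpin_character_inv`). For `V`,
the matrices of `W` are real and of finite order, so `w` and `w⁻¹` have the same characteristic
polynomial (`detOneSub_inv`). Spin characters vanish at odd elements and at elements `x` conjugate
to `z x`, so only even split classes contribute (`isEvenSplit_of_spinProduct_ne_zero`). Since the
kernel of `θ` is `{1, z}` and `χ(x) tr(x)|_B` does not change under `x ↦ z x`, the summand depends
only on the class of `θ(x)`.

**Coinvariants.** The graded trace of `w ∈ W` on the coinvariant algebra is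
`∏ (1 - t^dᵢ) / det(1 - t w)` (`mk_trace_coinvRep`). Passing from a graded algebra to its quotient
by a regular homogeneous eigenvector of `w`, of degree `d` and eigenvalue `c`, multiplies the
graded trace by `1 - c t^d` (`mk_quotTrace_sup_span`). For an eigenbasis of `w` in `V` the last
quotient is the ground field, and this gives the graded trace `1 / det(1 - t w)` of the symmetric
algebra (`prod_mul_mk_quotTrace_bot`). For the basic invariants the last quotient is the
coinvariant algebra. That they form a regular sequence (`mem_span_of_mul_invariant_mem`) is where
reflections enter, by Chevalley's argument with Demazure operators.
-/

noncomputable section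

namespace SpinWeyl

open scoped TensorProduct

/-! ### Homomorphisms of super modules -/

namespace SuperModule

variable {A : Type*} [Ring A] [Algebra ℂ A] {𝒜 : ZMod 2 → Submodule ℂ A}
  {M N : Type*} [AddCommGroup M] [Module ℂ M] [AddCommGroup N] [Module ℂ N]

/-- The parity involution of a super module: `1` on the even part, `-1` on the odd part. -/
def sgn (S : SuperModule 𝒜 M) : M →ₗ[ℂ] M :=
  (2 : ℂ) • (S.part 0).projection (S.part 1) S.isCompl - LinearMap.id

theorem exists_add (S : SuperModule 𝒜 M) (m : M) :
    ∃ a ∈ S.part 0, ∃ b ∈ S.part 1, a + b = m :=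
  Submodule.mem_sup.1 (by rw [S.isCompl.sup_eq_top]; trivial)

theorem sgn_even (S : SuperModule 𝒜 M) {m : M} (hm : m ∈ S.part 0) : S.sgn m = m := by
  have : (S.part 0).projection (S.part 1) S.isCompl m = m := by simpa using hm
  simp [sgn, this, two_smul]

theorem sgn_odd (S : SuperModule 𝒜 M) {m : M} (hm : m ∈ S.part 1) : S.sgn m = -m := by
  have : (S.part 0).projection (S.part 1) S.isCompl m = 0 := by simpa using hm
  simp [sgn, this]

theorem zmod_two_cases (q : ZMod 2) : q = 0 ∨ q = 1 := by
  revert q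
  decide

theorem sgn_of_mem (S : SuperModule 𝒜 M) {q : ZMod 2} {m : M} (hm : m ∈ S.part q) :
    S.sgn m = (-1 : ℂ) ^ q.val • m := by
  rcases zmod_two_cases q with rfl | rfl
  · simpa using S.sgn_even hm
  · simpa [ZMod.val_one] using S.sgn_odd hm

theorem sgn_sgn (S : SuperModule 𝒜 M) (m : M) : S.sgn (S.sgn m) = m := by
  obtain ⟨a, ha, b, hb, rfl⟩ := S.exists_add m
  simp [S.sgn_even ha, S.sgn_odd hb]

theorem mem_part_of_sgn (S : SuperModule 𝒜 M) {q : ZMod 2} {m : M}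
    (hm : S.sgn m = (-1 : ℂ) ^ q.val • m) : m ∈ S.part q := by
  obtain ⟨a, ha, b, hb, rfl⟩ := S.exists_add m
  rw [map_add, S.sgn_even ha, S.sgn_odd hb] at hm
  have : IsAddTorsionFree M := .of_isTorsionFree ℂ M
  rcases zmod_two_cases q with rfl | rfl
  · have hm' : -b = b := by simpa using hm
    rw [self_eq_neg.1 hm'.symm, add_zero]
    exact ha
  · have hm' : a = -a := by simpa [ZMod.val_one] using hm
    rw [self_eq_neg.1 hm', zero_add]
    exact hb

theorem neg_one_pow_val_add (p q : ZMod 2) :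
    (-1 : ℂ) ^ (p + q).val = (-1) ^ p.val * (-1) ^ q.val := by
  have h : ∀ p q : ZMod 2, (-1 : ℤ) ^ (p + q).val = (-1) ^ p.val * (-1) ^ q.val := by decide
  exact_mod_cast congrArg (Int.cast : ℤ → ℂ) (h p q)

theorem neg_one_pow_val_mul_self (p : ZMod 2) : (-1 : ℂ) ^ p.val * (-1) ^ p.val = 1 := by
  rw [← mul_pow]; simp

theorem sgn_act (S : SuperModule 𝒜 M) {p : ZMod 2} {a : A} (ha : a ∈ 𝒜 p) (m : M) :
    S.sgn (S.act a m) = (-1 : ℂ) ^ p.val • S.act a (S.sgn m) := by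
  obtain ⟨x, hx, y, hy, rfl⟩ := S.exists_add m
  simp only [map_add]
  rw [S.sgn_of_mem (S.act_mem p 0 a x ha hx), S.sgn_of_mem (S.act_mem p 1 a y ha hy),
    S.sgn_of_mem hx, S.sgn_of_mem hy, neg_one_pow_val_add, neg_one_pow_val_add]
  simp only [map_smul, smul_add, smul_smul]

/-- An odd element has trace zero: it anticommutes with the parity involution. -/
theorem character_odd (S : SuperModule 𝒜 M) {a : A} (ha : a ∈ 𝒜 1) : S.character a = 0 := by
  have h1 : S.act a * S.sgn = -(S.sgn * S.act a) := by
    ext m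
    have := S.sgn_act ha m
    simp [this, ZMod.val_one]
  have h2 : S.sgn * S.sgn = 1 := by
    ext m
    simp [S.sgn_sgn]
  have h3 : S.character a = -S.character a := by
    rw [character]
    conv_lhs => rw [← mul_one (S.act a), ← h2, ← mul_assoc, h1, neg_mul, map_neg,
      LinearMap.trace_mul_comm, ← mul_assoc, h2, one_mul]
  exact self_eq_neg.1 h3

/-- The linear maps that commute with the action, without signs or gradings. -/
def intertwiners (S : SuperModule 𝒜 M) (T : SuperModule 𝒜 N) : Submodule ℂ (M →ₗ[ℂ] N) where
  carrier := {f | ∀ a m, f (S.act a m) = T.act a (f m)}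
  zero_mem' := by simp
  add_mem' hf hg a m := by simp [hf a m, hg a m]
  smul_mem' c f hf a m := by simp [hf a m]

/-- The even part of a linear map plus `ε` times its odd part, where `ε` is the parity
involution. It trades homomorphisms with the sign rule for homomorphisms without signs. -/
def signTwist (S : SuperModule 𝒜 M) (T : SuperModule 𝒜 N) (f : M →ₗ[ℂ] N) : M →ₗ[ℂ] N :=
  (2⁻¹ : ℂ) • (f + T.sgn ∘ₗ f ∘ₗ S.sgn) + (2⁻¹ : ℂ) • (T.sgn ∘ₗ f - f ∘ₗ S.sgn)

theorem signTwist_signTwist (S : SuperModule 𝒜 M) (T : SuperModule 𝒜 N) (f : M →ₗ[ℂ] N) :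
    signTwist S T (signTwist S T f) = f := by
  ext m
  simp only [signTwist, LinearMap.add_apply, LinearMap.smul_apply, LinearMap.sub_apply,
    LinearMap.comp_apply, map_add, map_smul, map_sub, sgn_sgn]
  module

/-- `signTwist` as a linear automorphism. -/
def signTwistEquiv (S : SuperModule 𝒜 M) (T : SuperModule 𝒜 N) :
    (M →ₗ[ℂ] N) ≃ₗ[ℂ] (M →ₗ[ℂ] N) :=
  LinearEquiv.ofInvolutive
    { toFun := signTwist S T
      map_add' := fun f g => by
        simp only [signTwist, LinearMap.add_comp, LinearMap.comp_add]
        module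
      map_smul' := fun c f => by
        simp only [signTwist, LinearMap.smul_comp, LinearMap.comp_smul, RingHom.id_apply]
        module }
    (signTwist_signTwist S T)

theorem signTwistEquiv_apply (S : SuperModule 𝒜 M) (T : SuperModule 𝒜 N) (f : M →ₗ[ℂ] N) :
    signTwistEquiv S T f = signTwist S T f := rfl

theorem sgn_apply_of_mem_homPart (S : SuperModule 𝒜 M) (T : SuperModule 𝒜 N) {p : ZMod 2}
    {f : M →ₗ[ℂ] N} (hf : f ∈ S.homPart T p) (m : M) :
    T.sgn (f m) = (-1 : ℂ) ^ p.val • f (S.sgn m) := by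
  obtain ⟨x, hx, y, hy, rfl⟩ := S.exists_add m
  simp only [map_add]
  rw [T.sgn_of_mem (hf.1 0 x hx), T.sgn_of_mem (hf.1 1 y hy),
    S.sgn_of_mem hx, S.sgn_of_mem hy, neg_one_pow_val_add, neg_one_pow_val_add]
  simp only [map_smul, smul_add, smul_smul]
  ring_nf

theorem mem_homPart_of_sgn (S : SuperModule 𝒜 M) (T : SuperModule 𝒜 N) {p : ZMod 2}
    {f : M →ₗ[ℂ] N} (h : ∀ m, T.sgn (f m) = (-1 : ℂ) ^ p.val • f (S.sgn m))
    (h' : ∀ q, ∀ a ∈ 𝒜 q, ∀ m, f (S.act a m) = (-1 : ℂ) ^ (p * q).val • T.act a (f m)) :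
    f ∈ S.homPart T p := by
  refine ⟨fun q m hm => T.mem_part_of_sgn ?_, h'⟩
  rw [h, S.sgn_of_mem hm, map_smul, smul_smul, neg_one_pow_val_add, mul_comm]

/-- If `f` is odd and obeys the sign rule, then `ε ∘ f` commutes with the action; conversely the
even part of an intertwiner, and `ε` times its odd part, obey the sign rule. -/
theorem map_signTwist_hom (S : SuperModule 𝒜 M) (T : SuperModule 𝒜 N) (h𝒜 : 𝒜 0 ⊔ 𝒜 1 = ⊤) :
    (S.hom T).map (signTwistEquiv S T : (M →ₗ[ℂ] N) →ₗ[ℂ] (M →ₗ[ℂ] N)) = S.intertwiners T := by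
  have hdec : ∀ {f : M →ₗ[ℂ] N}, (∀ q, ∀ a ∈ 𝒜 q, ∀ m, f (S.act a m) = T.act a (f m)) →
      f ∈ S.intertwiners T := by
    intro f hf a m
    obtain ⟨x, hx, y, hy, rfl⟩ := Submodule.mem_sup.1 (h𝒜 ▸ Submodule.mem_top : a ∈ 𝒜 0 ⊔ 𝒜 1)
    simp [hf 0 x hx, hf 1 y hy]
  apply le_antisymm
  · rw [Submodule.map_le_iff_le_comap]
    refine sup_le (fun f hf => ?_) (fun f hf => ?_)
    · have h := S.sgn_apply_of_mem_homPart T hf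
      have e : signTwistEquiv S T f = f := by
        ext m
        have h1 : T.sgn (f m) = f (S.sgn m) := by simpa using h m
        have h2 : T.sgn (f (S.sgn m)) = f m := by simpa [sgn_sgn] using h (S.sgn m)
        simp only [signTwistEquiv_apply, signTwist, LinearMap.add_apply, LinearMap.smul_apply,
          LinearMap.sub_apply, LinearMap.comp_apply, h1, h2]
        module
      rw [Submodule.mem_comap, LinearEquiv.coe_coe, e]
      exact hdec fun q a ha m => by simpa using hf.2 q a ha m
    · have h := S.sgn_apply_of_mem_homPart T hf
      have e : signTwistEquiv S T f = T.sgn ∘ₗ f := by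
        ext m
        have h1 : f (S.sgn m) = -T.sgn (f m) := by simp [h m, ZMod.val_one]
        simp only [signTwistEquiv_apply, signTwist, LinearMap.add_apply, LinearMap.smul_apply,
          LinearMap.sub_apply, LinearMap.comp_apply, h1, map_neg, sgn_sgn]
        module
      rw [Submodule.mem_comap, LinearEquiv.coe_coe, e]
      refine hdec fun q a ha m => ?_
      simp only [LinearMap.comp_apply, hf.2 q a ha m, map_smul, T.sgn_act ha, one_mul, smul_smul,
        neg_one_pow_val_mul_self, one_smul]
  · intro f hf
    refine ⟨signTwist S T f, ?_, signTwist_signTwist S T f⟩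
    refine Submodule.add_mem_sup (S.mem_homPart_of_sgn T ?_ ?_) (S.mem_homPart_of_sgn T ?_ ?_)
    · intro m
      simp [sgn_sgn, add_comm]
    · intro q a ha m
      have := neg_one_pow_val_mul_self q
      simp [hf a, S.sgn_act ha, T.sgn_act ha, smul_smul, this]
    · intro m
      simp [sgn_sgn, ZMod.val_one, ← smul_neg]
    · intro q a ha m
      simp [hf a, S.sgn_act ha, T.sgn_act ha, smul_sub, smul_comm (2⁻¹ : ℂ)]

/-- Homomorphisms with the sign rule and plain intertwiners have the same dimension. -/
theorem finrank_hom (S : SuperModule 𝒜 M) (T : SuperModule 𝒜 N) (h𝒜 : 𝒜 0 ⊔ 𝒜 1 = ⊤) :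
    Module.finrank ℂ (S.hom T) = Module.finrank ℂ (S.intertwiners T) := by
  rw [← map_signTwist_hom S T h𝒜]
  exact (LinearEquiv.finrank_map_eq _ _).symm

end SuperModule

/-! ### Traces on Clifford modules -/

section CliffordTrace

variable {V : Type*} [AddCommGroup V] [Module ℂ V] {Q : QuadraticForm ℂ V}

open CliffordAlgebra

theorem prod_map_ι_mem_evenOdd (l : List V) :
    (l.map (ι Q)).prod ∈ evenOdd Q (l.length : ZMod 2) := by
  induction l with
  | nil => simpa using SetLike.GradedOne.one_mem (A := evenOdd Q)
  | cons v l ih =>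
    rw [List.map_cons, List.prod_cons, List.length_cons, Nat.cast_succ, add_comm]
    exact SetLike.GradedMul.mul_mem (ι_mem_evenOdd_one Q v) ih

/-- Moving a vector past a product of vectors costs the expected sign, up to multiples of
products with one factor less. -/
theorem prod_mul_ι_sub_mem (v : V) (l : List V) :
    (l.map (ι Q)).prod * ι Q v - (-1 : ℂ) ^ l.length • (ι Q v * (l.map (ι Q)).prod) ∈
      Submodule.span ℂ {x | ∃ l' : List V, l'.length < l.length ∧ x = (l'.map (ι Q)).prod} := by
  induction l with
  | nil => simp
  | cons w l ih =>
    rw [List.map_cons, List.prod_cons, List.length_cons]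
    have h1 : ι Q v * (ι Q w * (l.map (ι Q)).prod) =
        QuadraticMap.polar Q v w • (l.map (ι Q)).prod - ι Q w * (ι Q v * (l.map (ι Q)).prod) := by
      rw [← mul_assoc, eq_sub_iff_add_eq.2 (ι_mul_ι_add_swap (Q := Q) v w), sub_mul,
        ← Algebra.smul_def, mul_assoc]
    have h2 : ι Q w * (l.map (ι Q)).prod * ι Q v -
          (-1 : ℂ) ^ (l.length + 1) • (ι Q v * (ι Q w * (l.map (ι Q)).prod)) =
        ι Q w * ((l.map (ι Q)).prod * ι Q v - (-1 : ℂ) ^ l.length • (ι Q v * (l.map (ι Q)).prod)) +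
        ((-1 : ℂ) ^ l.length * QuadraticMap.polar Q v w) • (l.map (ι Q)).prod := by
      rw [h1, mul_sub, mul_assoc, mul_smul_comm]
      module
    rw [h2]
    refine add_mem ?_ (Submodule.smul_mem _ _ (Submodule.subset_span ⟨l, by simp, rfl⟩))
    have hle : Submodule.span ℂ
          {x | ∃ l' : List V, l'.length < l.length ∧ x = (l'.map (ι Q)).prod} ≤
        (Submodule.span ℂ {x | ∃ l' : List V, l'.length < l.length + 1 ∧
          x = (l'.map (ι Q)).prod}).comap (LinearMap.mulLeft ℂ (ι Q w)) := by
      rw [Submodule.span_le]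
      rintro _ ⟨l', hl', rfl⟩
      exact Submodule.subset_span ⟨w :: l', by simpa using hl', by simp⟩
    exact hle ih

/-- A trace functional on the Clifford algebra that kills `1` and all odd elements is zero. -/
theorem eq_zero_of_trace_functional (φ : CliffordAlgebra Q →ₗ[ℂ] ℂ)
    (hφ : ∀ a b, φ (a * b) = φ (b * a)) (h1 : φ 1 = 0) (hodd : ∀ a ∈ evenOdd Q 1, φ a = 0) :
    φ = 0 := by
  -- For a product of even length, moving the first factor cyclically to the end does not change
  -- `φ`, while anticommuting it back changes the sign, up to shorter products.
  have key : ∀ (k : ℕ) (l : List V), l.length = k → φ (l.map (ι Q)).prod = 0 := by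
    intro k
    induction k using Nat.strong_induction_on with
    | _ k ih =>
      intro l hl
      rcases l with _ | ⟨v, l⟩
      · simpa using h1
      rcases Nat.even_or_odd l.length with he | ho
      · apply hodd
        have := prod_map_ι_mem_evenOdd (Q := Q) (v :: l)
        have e : (((v :: l).length : ℕ) : ZMod 2) = 1 := by
          rw [List.length_cons, Nat.cast_succ, (ZMod.natCast_eq_zero_iff_even).2 he, zero_add]
        rwa [e] at this
      · have hz : ∀ x ∈ Submodule.span ℂ
            {x | ∃ l' : List V, l'.length < l.length ∧ x = (l'.map (ι Q)).prod}, φ x = 0 := by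
          intro x hx
          induction hx using Submodule.span_induction with
          | mem x hx =>
            obtain ⟨l', hl', rfl⟩ := hx
            exact ih l'.length (by rw [← hl, List.length_cons]; omega) l' rfl
          | zero => simp
          | add x y _ _ hx hy => simp [hx, hy]
          | smul c x _ hx => simp [hx]
        have h := hz _ (prod_mul_ι_sub_mem (Q := Q) v l)
        rw [ho.neg_one_pow, map_sub, map_smul, hφ, List.map_cons, List.prod_cons] at *
        simpa [← two_mul] using h
  ext x
  have hx : x ∈ Algebra.adjoin ℂ (Set.range (ι Q)) := by rw [adjoin_range_ι]; trivial
  rw [← Subalgebra.mem_toSubmodule, Algebra.adjoin_eq_span] at hx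
  induction hx using Submodule.span_induction with
  | mem x hx =>
    obtain ⟨l, hl, rfl⟩ := Submonoid.exists_list_of_mem_closure hx
    choose! g hg using hl
    have : l = (l.map g).map (ι Q) := by
      rw [List.map_map]
      conv_lhs => rw [← List.map_id l]
      exact List.map_congr_left fun y hy => (hg y hy).symm
    rw [this]
    exact key _ _ rfl
  | zero => simp
  | add x y _ _ hx hy => simp [hx, hy]
  | smul c x _ hx => simp [hx]

/-- The character of a Clifford super module is invariant under reversal. -/
theorem character_reverse {U : Type*} [AddCommGroup U] [Module ℂ U]
    (S : SuperModule (evenOdd Q) U) (c : CliffordAlgebra Q) :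
    S.character (reverse c) = S.character c := by
  have h := eq_zero_of_trace_functional
    ((LinearMap.trace ℂ U ∘ₗ S.act.toLinearMap) ∘ₗ reverse -
      LinearMap.trace ℂ U ∘ₗ S.act.toLinearMap)
    (fun a b => by
      simp [reverse.map_mul, LinearMap.trace_mul_comm ℂ (S.act a),
        LinearMap.trace_mul_comm ℂ (S.act (reverse a))])
    (by simp)
    (fun a ha => by
      have h1 : S.character a = 0 := S.character_odd ha
      have h2 : S.character (reverse a) = 0 := S.character_odd (by simpa using ha)
      simp only [SuperModule.character] at h1 h2
      simp [h1, h2])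
  exact sub_eq_zero.1 (LinearMap.congr_fun h c)

end CliffordTrace

/-! ### The double cover -/

section Cover

variable {n : ℕ} {M : CoxeterMatrix (Fin n)} {W : Type*} [Group W] (cs : CoxeterSystem M W)

/-- The generators `z` and `tᵢ` go to involutions that are fixed by the reversal, so inversion on
`W̃` corresponds to the reversal of the Clifford algebra. -/
theorem coverToCl_inv (x : Cover M) :
    ((coverToCl M x⁻¹ : (Cl M)ˣ) : Cl M) =
      CliffordAlgebra.reverse ((coverToCl M x : (Cl M)ˣ) : Cl M) := by
  have hgen : ∀ o : Option (Fin n), (((coverToCl M (PresentedGroup.of o))⁻¹ : (Cl M)ˣ) : Cl M) =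
      CliffordAlgebra.reverse ((coverToCl M (PresentedGroup.of o) : (Cl M)ˣ) : Cl M) := by
    rintro (_ | i)
    · simp [coverToCl, Cover.lift, PresentedGroup.toGroup.of]
    · rw [coverToCl, Cover.lift, PresentedGroup.toGroup.of]
      simp [clRoot]
  rw [map_inv]
  induction x using PresentedGroup.induction_on with
  | _ x =>
    induction x using FreeGroup.induction_on with
    | C1 => simp
    | of o => exact hgen o
    | inv_of o h =>
      have h' := congrArg CliffordAlgebra.reverse h
      rw [CliffordAlgebra.reverse_reverse] at h'
      rw [map_inv (PresentedGroup.mk _), map_inv (coverToCl M), inv_inv]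
      exact h'.symm
    | mul x y hx hy =>
      rw [map_mul (PresentedGroup.mk _), map_mul (coverToCl M), mul_inv_rev, Units.val_mul, hx, hy,
        Units.val_mul, CliffordAlgebra.reverse.map_mul]

theorem basicSpin_character_inv {U : Type*} [AddCommGroup U] [Module ℂ U]
    (S : SuperModule (CliffordAlgebra.evenOdd (quadForm M)) U) (x : Cover M) :
    (basicSpin S).character (toSpin x⁻¹) = (basicSpin S).character (toSpin x) := by
  have h : ∀ y : Cover M,
      (basicSpin S).character (toSpin y) = S.character (coverToCl M y : Cl M) := by
    intro y
    simp [SuperModule.character, basicSpin, SuperModule.pullback, spinToCl, spinLift_toSpin]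
  rw [h, h, coverToCl_inv, character_reverse]

theorem z_sq : z M * z M = 1 := by
  have : PresentedGroup.mk (coverRels M) (FreeGroup.of none ^ 2) = 1 :=
    (PresentedGroup.one_of_mem (Or.inl (Or.inl rfl)))
  rw [map_pow, pow_two] at this
  exact this

theorem z_mul_comm (x : Cover M) : z M * x = x * z M := by
  have hgen : ∀ o : Option (Fin n), Commute (z M) (PresentedGroup.of o) := by
    rintro (_ | i)
    · exact Commute.refl _
    · have : PresentedGroup.mk (coverRels M) (FreeGroup.of none * FreeGroup.of (some i) *
          (FreeGroup.of none)⁻¹ * (FreeGroup.of (some i))⁻¹) = 1 :=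
        PresentedGroup.one_of_mem (Or.inl (Or.inr ⟨i, rfl⟩))
      simp only [map_mul, map_inv] at this
      rw [mul_inv_eq_one, mul_inv_eq_iff_eq_mul] at this
      exact this
  induction x using PresentedGroup.induction_on with
  | _ x =>
    induction x using FreeGroup.induction_on with
    | C1 => simp
    | of o => exact hgen o
    | inv_of o h =>
      rw [map_inv]
      exact (Commute.inv_right (hgen o)).eq
    | mul x y hx hy =>
      rw [map_mul]
      exact (Commute.mul_right (hx : Commute _ _) hy).eq

theorem θ_z : θ cs (z M) = 1 := by simp [θ, Cover.lift, z, PresentedGroup.toGroup.of]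

theorem θ_of_some (i : Fin n) : θ cs (PresentedGroup.of (some i)) = cs.simple i := by
  simp [θ, Cover.lift, PresentedGroup.toGroup.of]

theorem θ_surjective : Function.Surjective (θ cs) := by
  rw [← MonoidHom.range_eq_top, eq_top_iff, ← cs.subgroup_closure_range_simple,
    Subgroup.closure_le]
  rintro _ ⟨i, rfl⟩
  exact ⟨_, θ_of_some cs i⟩

/-- The kernel of the covering map is generated by `z`: by its presentation `W` maps to
`W̃ / ⟨z⟩`, and this splits the projection `W̃ / ⟨z⟩ → W`. -/
theorem eq_one_or_eq_z_of_θ_eq_one {x : Cover M} (hx : θ cs x = 1) : x = 1 ∨ x = z M := by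
  have hN : (Subgroup.zpowers (z M)).Normal :=
    ⟨fun y hy g => by
      obtain ⟨k, rfl⟩ := hy
      have : Commute g (z M ^ k) := (Commute.zpow_right (z_mul_comm g).symm k)
      rw [this.eq, mul_inv_cancel_right]
      exact ⟨k, rfl⟩⟩
  have hlift : M.IsLiftable (fun i =>
      (QuotientGroup.mk' (Subgroup.zpowers (z M))) (PresentedGroup.of (some i))) := by
    intro i j
    by_cases h : M i j = 0
    · simp [h]
    have h1 : PresentedGroup.mk (coverRels M)
        ((FreeGroup.of (some i) * FreeGroup.of (some j)) ^ M i j *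
          (FreeGroup.of none ^ (M i j + 1))⁻¹) = 1 :=
      PresentedGroup.one_of_mem (Or.inr ⟨i, j, h, rfl⟩)
    rw [map_mul, map_inv, mul_inv_eq_one, map_pow, map_pow, map_mul] at h1
    rw [← map_mul, ← map_pow]
    refine (congrArg _ h1).trans ?_
    exact (QuotientGroup.eq_one_iff _).2 (pow_mem (Subgroup.mem_zpowers (z M)) _)
  have hcomp : (cs.lift ⟨_, hlift⟩).comp (θ cs) = QuotientGroup.mk' (Subgroup.zpowers (z M)) := by
    apply PresentedGroup.ext
    rintro (_ | i)
    · have : θ cs (PresentedGroup.of none) = 1 := θ_z cs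
      rw [MonoidHom.comp_apply, this, map_one]
      exact ((QuotientGroup.eq_one_iff _).2 (Subgroup.mem_zpowers (z M))).symm
    · rw [MonoidHom.comp_apply, θ_of_some, cs.lift_apply_simple hlift]
  have h := DFunLike.congr_fun hcomp x
  rw [MonoidHom.comp_apply, hx, map_one] at h
  obtain ⟨k, hk⟩ := (QuotientGroup.eq_one_iff x).1 h.symm
  dsimp only at hk
  rcases Int.even_or_odd' k with ⟨m, rfl | rfl⟩
  · left
    rw [← hk, zpow_mul, zpow_ofNat, pow_two, z_sq, one_zpow]
  · right
    rw [← hk, zpow_add, zpow_mul, zpow_ofNat, pow_two, z_sq, one_zpow, one_mul, zpow_one]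

theorem eq_or_eq_z_mul {x y : Cover M} (h : θ cs x = θ cs y) : x = y ∨ x = z M * y := by
  have : θ cs (x * y⁻¹) = 1 := by simp [h]
  rcases eq_one_or_eq_z_of_θ_eq_one cs this with h | h
  · left; exact mul_inv_eq_one.1 h
  · right; exact mul_inv_eq_iff_eq_mul.1 h

theorem finite_cover [Finite W] (cs : CoxeterSystem M W) : Finite (Cover M) := by
  refine Finite.of_surjective
    (fun p : W × Bool => bif p.2 then Function.surjInv (θ_surjective cs) p.1
      else z M * Function.surjInv (θ_surjective cs) p.1) fun x => ?_
  rcases eq_or_eq_z_mul cs (Function.surjInv_eq (θ_surjective cs) (θ cs x)).symm with h | h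
  · exact ⟨(θ cs x, true), h.symm⟩
  · exact ⟨(θ cs x, false), h.symm⟩

theorem toSpin_mul (x y : Cover M) : toSpin (x * y) = toSpin x * toSpin y :=
  map_mul toSpinHom x y

theorem span_range_toSpin : Submodule.span ℂ (Set.range (toSpin (M := M))) = ⊤ := by
  rw [eq_top_iff]
  rintro a -
  obtain ⟨a, rfl⟩ := RingQuot.mkAlgHom_surjective ℂ (spinRel M) a
  induction a using MonoidAlgebra.induction_on with
  | of x => exact Submodule.subset_span ⟨x, rfl⟩
  | add x y hx hy => rw [map_add]; exact add_mem hx hy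
  | smul c x hx => rw [map_smul]; exact Submodule.smul_mem _ _ hx

theorem spinPart_sup : spinPart M 0 ⊔ spinPart M 1 = ⊤ := by
  rw [eq_top_iff, ← span_range_toSpin, Submodule.span_le]
  rintro _ ⟨x, rfl⟩
  have h : ∀ p : Multiplicative (ZMod 2),
      p = Multiplicative.ofAdd 0 ∨ p = Multiplicative.ofAdd 1 := by
    decide
  rcases h (parity M x) with h | h
  · exact Submodule.mem_sup_left (Submodule.subset_span ⟨x, h, rfl⟩)
  · exact Submodule.mem_sup_right (Submodule.subset_span ⟨x, h, rfl⟩)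

/-- The representation of `W̃` underlying a spin module. -/
def coverRep {E : Type*} [AddCommGroup E] [Module ℂ E] (S : SuperModule (spinPart M) E) :
    Representation ℂ (Cover M) E :=
  (S.act : SpinAlgebra M →* Module.End ℂ E).comp toSpinHom

/-- Intertwiners of spin modules are intertwiners of the representations of `W̃`. -/
def intertwinersEquiv {E F : Type*} [AddCommGroup E] [Module ℂ E] [AddCommGroup F] [Module ℂ F]
    (S : SuperModule (spinPart M) E) (T : SuperModule (spinPart M) F) :
    S.intertwiners T ≃ₗ[ℂ] Representation.IntertwiningMap (coverRep S) (coverRep T) where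
  toFun f := f.1.intertwiningMap_of_isIntertwiningMap _ _ fun x m => f.2 (toSpin x) m
  map_add' _ _ := rfl
  map_smul' _ _ := rfl
  invFun g := ⟨g.toLinearMap, by
    intro a m
    have ha : a ∈ Submodule.span ℂ (Set.range (toSpin (M := M))) := by
      rw [span_range_toSpin]; trivial
    induction ha using Submodule.span_induction with
    | mem a ha =>
      obtain ⟨x, rfl⟩ := ha
      exact g.isIntertwining _ _ x m
    | zero => simp
    | add a b _ _ ha hb => rw [map_add, map_add, LinearMap.add_apply, map_add, ha, hb]; rfl
    | smul c a _ ha => rw [map_smul, map_smul, LinearMap.smul_apply, map_smul, ha]; rfl⟩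

/-- The dimension of the space of homomorphisms of spin modules, by orthogonality of characters. -/
theorem finrank_hom_eq_sum [Fintype (Cover M)] {E F : Type*} [AddCommGroup E] [Module ℂ E]
    [FiniteDimensional ℂ E] [AddCommGroup F] [Module ℂ F] [FiniteDimensional ℂ F]
    (S : SuperModule (spinPart M) E) (T : SuperModule (spinPart M) F) :
    (Module.finrank ℂ (S.hom T) : ℂ) = (Nat.card (Cover M) : ℂ)⁻¹ *
      ∑ x : Cover M, S.character (toSpin x) * T.character (toSpin x⁻¹) := by
  have : Invertible (Nat.card (Cover M) : ℂ) :=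
    invertibleOfNonzero (by exact_mod_cast Nat.card_pos.ne')
  rw [SuperModule.finrank_hom _ _ spinPart_sup, (intertwinersEquiv S T).finrank_eq,
    ← Representation.card_inv_mul_sum_char_mul_char_eq_finrank, ← Equiv.sum_comp (Equiv.inv _)]
  congr 1
  refine Finset.sum_congr rfl fun x _ => ?_
  rw [mul_comm, Equiv.inv_apply, inv_inv]
  rfl

theorem tensorRep_character {E F : Type*} [AddCommGroup E] [Module ℂ E] [AddCommGroup F]
    [Module ℂ F] [FiniteDimensional ℂ E] [FiniteDimensional ℂ F]
    (S : SuperModule (spinPart M) E) (τ : Representation ℂ W F) (x : Cover M) :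
    (tensorRep cs S τ).character (toSpin x) =
      S.character (toSpin x) * LinearMap.trace ℂ F (τ (θ cs x)) := by
  rw [SuperModule.character, tensorRep, spinLift_toSpin]
  exact LinearMap.trace_tensorProduct' _ _

theorem character_conj {E : Type*} [AddCommGroup E] [Module ℂ E] (S : SuperModule (spinPart M) E)
    (u x : Cover M) : S.character (toSpin (u * x * u⁻¹)) = S.character (toSpin x) :=
  Representation.char_conj (coverRep S) x u

theorem character_z_mul {E : Type*} [AddCommGroup E] [Module ℂ E] (S : SuperModule (spinPart M) E)
    (x : Cover M) : S.character (toSpin (z M * x)) = -S.character (toSpin x) := by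
  simp [SuperModule.character, toSpin_mul, toSpin_z]

end Cover

/-! ### Graded traces on quotients by regular sequences -/

/-- The trace is additive in short exact sequences. -/
theorem trace_eq_add_of_exact {L N P : Type*} [AddCommGroup L] [Module ℂ L] [FiniteDimensional ℂ L]
    [AddCommGroup N] [Module ℂ N] [FiniteDimensional ℂ N]
    [AddCommGroup P] [Module ℂ P] [FiniteDimensional ℂ P]
    (i : L →ₗ[ℂ] N) (p : N →ₗ[ℂ] P) (hi : Function.Injective i) (hp : Function.Surjective p)
    (hip : ∀ x, p (i x) = 0) (hex : ∀ y, p y = 0 → ∃ x, i x = y)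
    (u : Module.End ℂ L) (v : Module.End ℂ N) (w : Module.End ℂ P)
    (huv : ∀ x, v (i x) = i (u x)) (hvw : ∀ y, p (v y) = w (p y)) :
    LinearMap.trace ℂ N v = LinearMap.trace ℂ L u + LinearMap.trace ℂ P w := by
  obtain ⟨s, hs⟩ := p.exists_rightInverse_of_surjective (LinearMap.range_eq_top.2 hp)
  have hs' : ∀ x, p (s x) = x := fun x => LinearMap.congr_fun hs x
  -- a section `s` of `p` yields a retraction `r` of `i` with `i r + s p = 1`
  choose r hr using fun y => hex (y - s (p y)) (by simp [hs'])
  let r' : N →ₗ[ℂ] L :=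
    { toFun := r
      map_add' := fun x y => hi (by simp only [map_add, hr]; abel)
      map_smul' := fun c x => hi (by simp only [map_smul, hr, smul_sub, RingHom.id_apply]) }
  have hr' : ∀ y, i (r' y) = y - s (p y) := hr
  have h1 : v = (v ∘ₗ i) ∘ₗ r' + (v ∘ₗ s) ∘ₗ p := by
    ext y
    simp [hr']
  have h2 : r' ∘ₗ (v ∘ₗ i) = u := by
    ext x
    apply hi
    simp [hr', huv, hip]
  have h3 : p ∘ₗ (v ∘ₗ s) = w := by
    ext x
    simp [hvw, hs']
  rw [h1, map_add, LinearMap.trace_comp_comm', h2, LinearMap.trace_comp_comm' p, h3]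

section Graded

variable {A : Type*} [CommRing A] [Algebra ℂ A] (𝒢 : ℕ → Submodule ℂ A)

/-- The image of the degree `k` piece in the quotient by an ideal. -/
def quotDeg (J : Ideal A) (k : ℕ) : Submodule ℂ (A ⧸ J) :=
  (𝒢 k).map (Ideal.Quotient.mkₐ ℂ J).toLinearMap

theorem quotientMap_mem_quotDeg {J : Ideal A} {w : A →ₐ[ℂ] A} (hJ : J ≤ J.comap w)
    (hw : ∀ k, ∀ x ∈ 𝒢 k, w x ∈ 𝒢 k) (k : ℕ) :
    ∀ x ∈ quotDeg 𝒢 J k, (Ideal.quotientMapₐ J w hJ).toLinearMap x ∈ quotDeg 𝒢 J k := by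
  rintro _ ⟨x, hx, rfl⟩
  exact ⟨w x, hw k x hx, rfl⟩

/-- The trace of a graded algebra endomorphism on the degree `k` piece of the quotient by a
stable ideal. -/
def quotTrace (J : Ideal A) (w : A →ₐ[ℂ] A) (hJ : J ≤ J.comap w)
    (hw : ∀ k, ∀ x ∈ 𝒢 k, w x ∈ 𝒢 k) (k : ℕ) : ℂ :=
  LinearMap.trace ℂ (quotDeg 𝒢 J k)
    ((Ideal.quotientMapₐ J w hJ).toLinearMap.restrict (quotientMap_mem_quotDeg 𝒢 hJ hw k))

theorem quotTrace_congr {J J' : Ideal A} (h : J = J') (w : A →ₐ[ℂ] A) (hJ : J ≤ J.comap w)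
    (hJ' : J' ≤ J'.comap w) (hw : ∀ k, ∀ x ∈ 𝒢 k, w x ∈ 𝒢 k) (k : ℕ) :
    quotTrace 𝒢 J w hJ hw k = quotTrace 𝒢 J' w hJ' hw k := by
  subst h
  rfl

instance [∀ k, FiniteDimensional ℂ (𝒢 k)] (J : Ideal A) (k : ℕ) :
    FiniteDimensional ℂ (quotDeg 𝒢 J k) :=
  inferInstanceAs (FiniteDimensional ℂ ((𝒢 k).map (Ideal.Quotient.mkₐ ℂ J).toLinearMap))

variable [GradedAlgebra 𝒢] [∀ k, FiniteDimensional ℂ (𝒢 k)]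

/-- In degrees at least `d`, multiplication by an element `f` of degree `d` that is regular
modulo `J` gives a short exact sequence `0 → (A/J)ₖ → (A/J)ₖ₊d → (A/(J + f))ₖ₊d → 0`. -/
theorem quotTrace_sup_span_add {J : Ideal A} (hJh : J.IsHomogeneous 𝒢) {w : A →ₐ[ℂ] A}
    (hJ : J ≤ J.comap w) (hw : ∀ k, ∀ x ∈ 𝒢 k, w x ∈ 𝒢 k) {f : A} {d : ℕ} (hf : f ∈ 𝒢 d)
    {c : ℂ} (hc : w f = c • f) (hreg : ∀ k, ∀ p ∈ 𝒢 k, p * f ∈ J → p ∈ J)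
    (hJ' : J ⊔ Ideal.span {f} ≤ (J ⊔ Ideal.span {f}).comap w) (k : ℕ) :
    quotTrace 𝒢 J w hJ hw (k + d) =
      c * quotTrace 𝒢 J w hJ hw k + quotTrace 𝒢 (J ⊔ Ideal.span {f}) w hJ' hw (k + d) := by
  have hi : ∀ x ∈ quotDeg 𝒢 J k,
      LinearMap.mulRight ℂ (Ideal.Quotient.mk J f) x ∈ quotDeg 𝒢 J (k + d) := by
    rintro _ ⟨x, hx, rfl⟩
    exact ⟨x * f, SetLike.GradedMul.mul_mem hx hf, map_mul (Ideal.Quotient.mk J) _ _⟩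
  have hp : ∀ x ∈ quotDeg 𝒢 J (k + d),
      (Ideal.Quotient.factorₐ ℂ (le_sup_left : J ≤ J ⊔ Ideal.span {f})).toLinearMap x ∈
        quotDeg 𝒢 (J ⊔ Ideal.span {f}) (k + d) := by
    rintro _ ⟨x, hx, rfl⟩
    exact ⟨x, hx, rfl⟩
  rw [quotTrace, trace_eq_add_of_exact
    (LinearMap.restrict _ hi)
    (LinearMap.restrict _ hp) ?_ ?_ ?_ ?_
    (c • (Ideal.quotientMapₐ J w hJ).toLinearMap.restrict (quotientMap_mem_quotDeg 𝒢 hJ hw k)) _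
    ((Ideal.quotientMapₐ _ w hJ').toLinearMap.restrict
      (quotientMap_mem_quotDeg 𝒢 hJ' hw (k + d))) ?_ ?_, map_smul, smul_eq_mul]
  · rfl
  · rw [← LinearMap.ker_eq_bot, LinearMap.ker_eq_bot']
    rintro ⟨_, x, hx, rfl⟩ h
    have h' : Ideal.Quotient.mk J (x * f) = 0 := congrArg Subtype.val h
    rw [Ideal.Quotient.eq_zero_iff_mem] at h'
    exact Subtype.ext (Ideal.Quotient.eq_zero_iff_mem.2 (hreg k x hx h'))
  · rintro ⟨_, x, hx, rfl⟩
    exact ⟨⟨_, x, hx, rfl⟩, rfl⟩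
  · rintro ⟨_, x, hx, rfl⟩
    apply Subtype.ext
    change Ideal.Quotient.mk (J ⊔ Ideal.span {f}) (x * f) = 0
    rw [Ideal.Quotient.eq_zero_iff_mem]
    exact Ideal.mem_sup_right (Ideal.mul_mem_left _ _ (Ideal.mem_span_singleton_self f))
  · rintro ⟨_, x, hx, rfl⟩ h
    have h' : Ideal.Quotient.mk (J ⊔ Ideal.span {f}) x = 0 := congrArg Subtype.val h
    rw [Ideal.Quotient.eq_zero_iff_mem] at h'
    obtain ⟨y, hy, t, ht, rfl⟩ := Submodule.mem_sup.1 h'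
    obtain ⟨b, rfl⟩ := Ideal.mem_span_singleton'.1 ht
    have e := DirectSum.decompose_of_mem_same 𝒢 hx
    rw [DirectSum.decompose_add, DirectSum.add_apply, Submodule.coe_add,
      DirectSum.coe_decompose_mul_add_of_right_mem 𝒢 hf] at e
    refine ⟨⟨_, DirectSum.decompose 𝒢 b k, SetLike.coe_mem _, rfl⟩, Subtype.ext ?_⟩
    change Ideal.Quotient.mk J ((DirectSum.decompose 𝒢 b k : A) * f) = Ideal.Quotient.mk J _
    rw [← e, map_add, Ideal.Quotient.eq_zero_iff_mem.2 (hJh _ hy), zero_add]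
  · rintro ⟨_, x, hx, rfl⟩
    apply Subtype.ext
    change Ideal.Quotient.mk J (w (x * f)) = c • Ideal.Quotient.mk J (w x) * Ideal.Quotient.mk J f
    rw [map_mul, hc, mul_smul_comm, smul_mul_assoc, ← map_mul]
    rfl
  · rintro ⟨_, x, hx, rfl⟩
    rfl

/-- In degrees below `d`, the quotient does not change when an element of degree `d` is added
to the ideal. -/
theorem quotTrace_sup_span_of_lt {J : Ideal A} (hJh : J.IsHomogeneous 𝒢) {w : A →ₐ[ℂ] A}
    (hJ : J ≤ J.comap w) (hw : ∀ k, ∀ x ∈ 𝒢 k, w x ∈ 𝒢 k) {f : A} {d : ℕ} (hf : f ∈ 𝒢 d)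
    (hJ' : J ⊔ Ideal.span {f} ≤ (J ⊔ Ideal.span {f}).comap w) {k : ℕ} (hk : k < d) :
    quotTrace 𝒢 (J ⊔ Ideal.span {f}) w hJ' hw k = quotTrace 𝒢 J w hJ hw k := by
  have hp : ∀ x ∈ quotDeg 𝒢 J k,
      (Ideal.Quotient.factorₐ ℂ (le_sup_left : J ≤ J ⊔ Ideal.span {f})).toLinearMap x ∈
        quotDeg 𝒢 (J ⊔ Ideal.span {f}) k := by
    rintro _ ⟨x, hx, rfl⟩
    exact ⟨x, hx, rfl⟩
  rw [quotTrace, quotTrace, trace_eq_add_of_exact (0 : PUnit →ₗ[ℂ] quotDeg 𝒢 J k)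
    (LinearMap.restrict _ hp) (fun _ _ _ => rfl) ?_ (by simp) ?_ 0 _
    ((Ideal.quotientMapₐ _ w hJ').toLinearMap.restrict
      (quotientMap_mem_quotDeg 𝒢 hJ' hw k)) (by simp) ?_, map_zero, zero_add]
  · rintro ⟨_, x, hx, rfl⟩
    exact ⟨⟨_, x, hx, rfl⟩, rfl⟩
  · rintro ⟨_, x, hx, rfl⟩ h
    have h' : Ideal.Quotient.mk (J ⊔ Ideal.span {f}) x = 0 := congrArg Subtype.val h
    rw [Ideal.Quotient.eq_zero_iff_mem] at h'
    obtain ⟨y, hy, t, ht, rfl⟩ := Submodule.mem_sup.1 h'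
    obtain ⟨b, rfl⟩ := Ideal.mem_span_singleton'.1 ht
    have e := DirectSum.decompose_of_mem_same 𝒢 hx
    rw [DirectSum.decompose_add, DirectSum.add_apply, Submodule.coe_add,
      DirectSum.coe_decompose_mul_of_right_mem_of_not_le 𝒢 hf (not_le.2 hk), add_zero] at e
    refine ⟨0, Subtype.ext ?_⟩
    change 0 = Ideal.Quotient.mk J _
    rw [← e, Ideal.Quotient.eq_zero_iff_mem.2 (hJh _ hy)]
  · rintro ⟨_, x, hx, rfl⟩
    rfl

/-- Adding a regular eigenvector of degree `d` and eigenvalue `c` to the ideal multiplies the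
graded trace on the quotient by `1 - c t^d`. -/
theorem mk_quotTrace_sup_span {J : Ideal A} (hJh : J.IsHomogeneous 𝒢) {w : A →ₐ[ℂ] A}
    (hJ : J ≤ J.comap w) (hw : ∀ k, ∀ x ∈ 𝒢 k, w x ∈ 𝒢 k) {f : A} {d : ℕ} (hf : f ∈ 𝒢 d)
    {c : ℂ} (hc : w f = c • f) (hreg : ∀ k, ∀ p ∈ 𝒢 k, p * f ∈ J → p ∈ J)
    (hJ' : J ⊔ Ideal.span {f} ≤ (J ⊔ Ideal.span {f}).comap w) :
    PowerSeries.mk (quotTrace 𝒢 (J ⊔ Ideal.span {f}) w hJ' hw) =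
      (1 - PowerSeries.C c * PowerSeries.X ^ d) * PowerSeries.mk (quotTrace 𝒢 J w hJ hw) := by
  ext k
  rw [sub_mul, one_mul, map_sub, mul_assoc, PowerSeries.coeff_C_mul, PowerSeries.coeff_X_pow_mul']
  simp only [PowerSeries.coeff_mk]
  split_ifs with h
  · obtain ⟨j, rfl⟩ := Nat.exists_eq_add_of_le' h
    rw [Nat.add_sub_cancel, quotTrace_sup_span_add 𝒢 hJh hJ hw hf hc hreg hJ']
    ring
  · rw [quotTrace_sup_span_of_lt 𝒢 hJh hJ hw hf hJ' (not_le.1 h), mul_zero, sub_zero]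

theorem span_image_le_comap {ι : Type*} {w : A →ₐ[ℂ] A} {f : ι → A} {c : ι → ℂ}
    (hc : ∀ i, w (f i) = c i • f i) (s : Set ι) :
    Ideal.span (f '' s) ≤ (Ideal.span (f '' s)).comap w := by
  rw [Ideal.span_le]
  rintro _ ⟨i, hi, rfl⟩
  change w (f i) ∈ Ideal.span (f '' s)
  rw [hc, Algebra.smul_def]
  exact Ideal.mul_mem_left _ _ (Ideal.subset_span ⟨i, hi, rfl⟩)

/-- The graded trace on the quotient by a regular sequence of homogeneous eigenvectors. -/
theorem mk_quotTrace_span_range {n : ℕ} {w : A →ₐ[ℂ] A} (hw : ∀ k, ∀ x ∈ 𝒢 k, w x ∈ 𝒢 k)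
    {f : Fin n → A} {d : Fin n → ℕ} (hf : ∀ i, f i ∈ 𝒢 (d i)) {c : Fin n → ℂ}
    (hc : ∀ i, w (f i) = c i • f i)
    (hreg : ∀ i k, ∀ p ∈ 𝒢 k, p * f i ∈ Ideal.span (f '' {j | j < i}) →
      p ∈ Ideal.span (f '' {j | j < i})) :
    PowerSeries.mk (quotTrace 𝒢 (Ideal.span (f '' Set.univ)) w (span_image_le_comap hc _) hw) =
      (∏ i, (1 - PowerSeries.C (c i) * PowerSeries.X ^ d i)) *
        PowerSeries.mk (quotTrace 𝒢 ⊥ w bot_le hw) := by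
  have key : ∀ m ≤ n, PowerSeries.mk (quotTrace 𝒢 (Ideal.span (f '' {j | (j : ℕ) < m})) w
        (span_image_le_comap hc _) hw) =
      (∏ i ∈ Finset.univ.filter (fun i : Fin n => (i : ℕ) < m),
          (1 - PowerSeries.C (c i) * PowerSeries.X ^ d i)) *
        PowerSeries.mk (quotTrace 𝒢 ⊥ w bot_le hw) := by
    intro m
    induction m with
    | zero =>
      intro _
      simp only [Nat.not_lt_zero, Finset.filter_false, Finset.prod_empty, one_mul]
      exact congrArg _ (funext fun k => quotTrace_congr 𝒢 (by simp) w _ _ hw k)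
    | succ m ih =>
      intro hm
      have hs : {j : Fin n | (j : ℕ) < m + 1} = insert ⟨m, hm⟩ {j : Fin n | (j : ℕ) < m} := by
        ext j
        simp only [Set.mem_ofPred_eq, Set.mem_insert_iff, Fin.ext_iff]
        omega
      have hJ : Ideal.span (f '' {j | (j : ℕ) < m + 1}) =
          Ideal.span (f '' {j | (j : ℕ) < m}) ⊔ Ideal.span {f ⟨m, hm⟩} := by
        rw [hs, Set.image_insert_eq, Ideal.span_insert, sup_comm]
      have hfs : (Finset.univ.filter fun i : Fin n => (i : ℕ) < m + 1) =
          insert ⟨m, hm⟩ (Finset.univ.filter fun i : Fin n => (i : ℕ) < m) := by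
        ext j
        simp only [Finset.mem_filter, Finset.mem_univ, true_and, Finset.mem_insert, Fin.ext_iff]
        omega
      have hJ' := hJ ▸ span_image_le_comap hc {j : Fin n | (j : ℕ) < m + 1}
      rw [hfs, Finset.prod_insert (by simp), mul_assoc, ← ih (by omega),
        ← mk_quotTrace_sup_span 𝒢 (J := Ideal.span (f '' {j | (j : ℕ) < m}))
          (Ideal.homogeneous_span _ _ ?_) _ hw (hf _) (hc _) (hreg ⟨m, hm⟩) hJ']
      · exact congrArg _ (funext fun k => quotTrace_congr 𝒢 hJ w _ _ hw k)
      · rintro _ ⟨i, -, rfl⟩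
        exact ⟨d i, hf i⟩
  have h := key n le_rfl
  rw [Finset.filter_true_of_mem (by simp)] at h
  rw [← h]
  exact congrArg _ (funext fun k => quotTrace_congr 𝒢 (by congr 1; ext; simp) w _ _ hw k)

end Graded

/-! ### The symmetric algebra -/

section Symmetric

variable {V : Type*} [AddCommGroup V] [Module ℂ V]

open scoped DirectSum

theorem ι_mem_symDeg (v : V) : SymmetricAlgebra.ι ℂ V v ∈ symDeg V 1 := by
  rw [symDeg, pow_one]
  exact ⟨v, rfl⟩

instance : SetLike.GradedMonoid (symDeg V) :=
  inferInstanceAs (SetLike.GradedMonoid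
    ((LinearMap.range (SymmetricAlgebra.ι ℂ V) ^ ·) : ℕ → Submodule ℂ _))

/-- The inclusion of `V` as the degree one piece of the graded symmetric algebra. -/
def symDegι : V →ₗ[ℂ] ⨁ k : ℕ, symDeg V k :=
  DirectSum.lof ℂ ℕ (fun k => symDeg V k) 1 ∘ₗ
    (SymmetricAlgebra.ι ℂ V).codRestrict _ ι_mem_symDeg

theorem symDegι_apply (v : V) :
    symDegι v = DirectSum.of (fun k => symDeg V k) 1 ⟨SymmetricAlgebra.ι ℂ V v, ι_mem_symDeg v⟩ :=
  rfl

instance : GradedAlgebra (symDeg V) :=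
  GradedAlgebra.ofAlgHom _ (SymmetricAlgebra.lift symDegι)
    (by
      apply SymmetricAlgebra.algHom_ext
      ext v
      simp [symDegι_apply])
    fun i x => by
    obtain ⟨x, hx⟩ := x
    dsimp only [Subtype.coe_mk, DirectSum.lof_eq_of]
    induction hx using Submodule.pow_induction_on_left' with
    | algebraMap r =>
      rw [AlgHom.commutes, DirectSum.algebraMap_apply]; rfl
    | add x y i hx hy ihx ihy =>
      rw [map_add, ihx, ihy, ← map_add]
      rfl
    | mem_mul m hm i x hx ih =>
      obtain ⟨_, rfl⟩ := hm
      rw [map_mul, ih, SymmetricAlgebra.lift_ι_apply, symDegι_apply, DirectSum.of_mul_of]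
      exact DirectSum.of_eq_of_gradedMonoid_eq (Sigma.subtype_ext (add_comm _ _) rfl)

instance [FiniteDimensional ℂ V] (k : ℕ) : FiniteDimensional ℂ (symDeg V k) :=
  Module.Finite.iff_fg.2 (Submodule.FG.pow (Module.Finite.iff_fg.1 inferInstance) k)

theorem symDeg_succ_le {n : ℕ} (b : Module.Basis (Fin n) ℂ V) (k : ℕ) :
    ∀ x ∈ symDeg V (k + 1),
      x ∈ Ideal.span ((fun i => SymmetricAlgebra.ι ℂ V (b i)) '' Set.univ) := by
  intro x hx
  rw [symDeg, pow_succ'] at hx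
  induction hx using Submodule.mul_induction_on' with
  | mem_mul_mem m hm y _ =>
    obtain ⟨v, rfl⟩ := hm
    apply Ideal.mul_mem_right
    rw [← b.sum_repr v, map_sum]
    refine Ideal.sum_mem _ fun i _ => ?_
    rw [map_smul, Algebra.smul_def]
    exact Ideal.mul_mem_left _ _ (Ideal.subset_span ⟨i, trivial, rfl⟩)
  | add x _ y _ hx hy => exact add_mem hx hy

theorem algebraMapInv_eq_zero {k : ℕ} (hk : 0 < k) {x : SymmetricAlgebra ℂ V}
    (hx : x ∈ symDeg V k) : SymmetricAlgebra.algebraMapInv x = 0 := by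
  obtain ⟨k, rfl⟩ := Nat.exists_eq_add_of_lt hk
  rw [zero_add, symDeg, pow_succ'] at hx
  induction hx using Submodule.mul_induction_on' with
  | mem_mul_mem m hm y _ =>
    obtain ⟨v, rfl⟩ := hm
    rw [map_mul, SymmetricAlgebra.algebraMapInv_ι, zero_mul]
  | add x _ y _ hx hy => rw [map_add, hx, hy, add_zero]

theorem mem_symDeg_zero {x : SymmetricAlgebra ℂ V} (hx : x ∈ symDeg V 0) :
    ∃ c : ℂ, algebraMap ℂ _ c = x := by
  rw [symDeg, pow_zero] at hx
  exact Submodule.mem_one.1 hx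

/-- The variables form a regular sequence in a polynomial ring. -/
theorem mem_span_X_of_mul_X_mem {σ : Type*} {s : Set σ} {i : σ} (hi : i ∉ s)
    {p : MvPolynomial σ ℂ}
    (hp : p * MvPolynomial.X i ∈ Ideal.span (MvPolynomial.X '' s : Set (MvPolynomial σ ℂ))) :
    p ∈ Ideal.span (MvPolynomial.X '' s : Set (MvPolynomial σ ℂ)) := by
  classical
  rw [MvPolynomial.mem_ideal_span_X_image] at hp ⊢
  intro m hm
  obtain ⟨j, hj, hmj⟩ := hp (m + Finsupp.single i 1) (by
    rw [MvPolynomial.mem_support_iff, MvPolynomial.coeff_mul_X]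
    exact MvPolynomial.mem_support_iff.1 hm)
  refine ⟨j, hj, ?_⟩
  have : i ≠ j := fun h => hi (h ▸ hj)
  simpa [Finsupp.single_apply, this] using hmj

theorem mem_span_ι_of_mul_ι_mem {n : ℕ} (b : Module.Basis (Fin n) ℂ V) {s : Set (Fin n)}
    {i : Fin n} (hi : i ∉ s) {p : SymmetricAlgebra ℂ V}
    (hp : p * SymmetricAlgebra.ι ℂ V (b i) ∈
      Ideal.span ((fun i => SymmetricAlgebra.ι ℂ V (b i)) '' s)) :
    p ∈ Ideal.span ((fun i => SymmetricAlgebra.ι ℂ V (b i)) '' s) := by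
  have h : ∀ x : SymmetricAlgebra ℂ V,
      x ∈ Ideal.span ((fun i => SymmetricAlgebra.ι ℂ V (b i)) '' s) ↔
      SymmetricAlgebra.equivMvPolynomial b x ∈
        Ideal.span (MvPolynomial.X '' s : Set (MvPolynomial (Fin n) ℂ)) := by
    intro x
    have : Ideal.span (MvPolynomial.X '' s : Set (MvPolynomial (Fin n) ℂ)) =
        (Ideal.span ((fun i => SymmetricAlgebra.ι ℂ V (b i)) '' s)).map
          (SymmetricAlgebra.equivMvPolynomial b) := by
      rw [Ideal.map_span, Set.image_image]
      simp
    rw [this]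
    exact (Ideal.apply_mem_of_equiv_iff
      (f := (SymmetricAlgebra.equivMvPolynomial b).toRingEquiv)).symm
  rw [h] at hp ⊢
  rw [map_mul, SymmetricAlgebra.equivMvPolynomial_ι_apply] at hp
  exact mem_span_X_of_mul_X_mem hi hp

/-- Molien's generating function: the graded trace of a diagonalizable map on the symmetric
algebra. The quotient of the symmetric algebra by an eigenbasis is the ground field. -/
theorem prod_mul_mk_quotTrace_bot {n : ℕ} (b : Module.Basis (Fin n) ℂ V)
    {w : SymmetricAlgebra ℂ V →ₐ[ℂ] SymmetricAlgebra ℂ V}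
    (hw : ∀ k, ∀ x ∈ symDeg V k, w x ∈ symDeg V k) {μ : Fin n → ℂ}
    (hμ : ∀ i, w (SymmetricAlgebra.ι ℂ V (b i)) = μ i • SymmetricAlgebra.ι ℂ V (b i)) :
    (∏ i, (1 - PowerSeries.C (μ i) * PowerSeries.X)) *
      PowerSeries.mk (quotTrace (symDeg V) ⊥ w bot_le hw) = 1 := by
  have : FiniteDimensional ℂ V := b.finiteDimensional_of_finite
  have h := mk_quotTrace_span_range (symDeg V) hw (f := fun i => SymmetricAlgebra.ι ℂ V (b i))
    (d := fun _ => 1) (fun i => ι_mem_symDeg _) hμ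
    (fun i k p _ hp => mem_span_ι_of_mul_ι_mem b (by simp) hp)
  simp only [pow_one] at h
  rw [← h]
  set J := Ideal.span ((fun i => SymmetricAlgebra.ι ℂ V (b i)) '' Set.univ) with hJ
  ext k
  rw [PowerSeries.coeff_mk, PowerSeries.coeff_one]
  rcases k with _ | k
  · rw [if_pos rfl, quotTrace]
    have h1 : quotDeg (symDeg V) J 0 = Submodule.span ℂ {1} := by
      apply le_antisymm
      · rintro _ ⟨x, hx, rfl⟩
        obtain ⟨c, rfl⟩ := mem_symDeg_zero hx
        rw [Submodule.mem_span_singleton]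
        exact ⟨c, by simpa using (Algebra.algebraMap_eq_smul_one c).symm⟩
      · rw [Submodule.span_le, Set.singleton_subset_iff]
        exact ⟨1, SetLike.GradedOne.one_mem, rfl⟩
    have h2 : (1 : SymmetricAlgebra ℂ V ⧸ J) ≠ 0 := by
      intro h0
      have hmem : (1 : SymmetricAlgebra ℂ V) ∈ J := Ideal.Quotient.eq_zero_iff_mem.1 h0
      have hle : J ≤ RingHom.ker (SymmetricAlgebra.algebraMapInv (R := ℂ) (M := V)) := by
        rw [hJ, Ideal.span_le]
        rintro _ ⟨i, -, rfl⟩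
        exact SymmetricAlgebra.algebraMapInv_ι _
      have := hle hmem
      rw [RingHom.mem_ker, map_one] at this
      exact one_ne_zero this
    have h3 : ((Ideal.quotientMapₐ J w (span_image_le_comap hμ _)).toLinearMap.restrict
        (quotientMap_mem_quotDeg (symDeg V) (span_image_le_comap hμ _) hw 0)) = LinearMap.id := by
      ext ⟨_, x, hx, rfl⟩
      obtain ⟨c, rfl⟩ := mem_symDeg_zero hx
      change Ideal.Quotient.mk J (w _) = Ideal.Quotient.mk J _
      rw [AlgHom.commutes]
    rw [h3, LinearMap.trace_id, h1, finrank_span_singleton h2, Nat.cast_one]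
  · rw [if_neg (by omega), quotTrace]
    have h1 : quotDeg (symDeg V) J (k + 1) = ⊥ := by
      rw [eq_bot_iff]
      rintro _ ⟨x, hx, rfl⟩
      exact Ideal.Quotient.eq_zero_iff_mem.2 (symDeg_succ_le b k x hx)
    have : Subsingleton (quotDeg (symDeg V) J (k + 1)) := by rw [h1]; infer_instance
    rw [Subsingleton.elim (LinearMap.restrict _ _) 0, map_zero]

end Symmetric

/-! ### Basic invariants form a regular sequence -/

section Chevalley

variable {n : ℕ} {M : CoxeterMatrix (Fin n)} {W : Type*} [Group W] (cs : CoxeterSystem M W)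

theorem symAct_ι {G V : Type*} [Group G] [AddCommGroup V] [Module ℂ V] (ρ : Representation ℂ G V)
    (g : G) (v : V) :
    symAct ρ g (SymmetricAlgebra.ι ℂ V v) = SymmetricAlgebra.ι ℂ V (ρ g v) := by
  simp [symAct]

theorem sum_symAct_mem_invariants {G V : Type*} [Group G] [Fintype G] [AddCommGroup V] [Module ℂ V]
    (ρ : Representation ℂ G V) (p : SymmetricAlgebra ℂ V) :
    ∑ g, symAct ρ g p ∈ invariants ρ := by
  intro h
  rw [map_sum]
  refine Eq.trans (Finset.sum_congr rfl fun g _ => ?_)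
    (Equiv.sum_comp (Equiv.mulLeft h) fun g => symAct ρ g p)
  rw [Equiv.coe_mulLeft, symAct_mul]
  rfl

/-- The simple root `βᵢ` as an element of the symmetric algebra. -/
def symRoot (i : Fin n) : SymmetricAlgebra ℂ (Fin n → ℂ) :=
  SymmetricAlgebra.ι ℂ (Fin n → ℂ) (root i)

theorem symRoot_ne_zero (i : Fin n) : symRoot i ≠ 0 := by
  intro h
  have h' := congrArg (SymmetricAlgebra.equivMvPolynomial (Pi.basisFun ℂ (Fin n))) h
  have e : root i = Pi.basisFun ℂ (Fin n) i := by simp [root]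
  rw [symRoot, e, SymmetricAlgebra.equivMvPolynomial_ι_apply, map_zero] at h'
  exact MvPolynomial.X_ne_zero i h'

/-- The Demazure operator: `p - sᵢ p` is divisible by the root `βᵢ`. -/
theorem exists_symRoot_mul_eq_sub (i : Fin n) (p : SymmetricAlgebra ℂ (Fin n → ℂ)) :
    ∃ q, symRoot i * q = p - symAct (reflectionRep cs) (cs.simple i) p := by
  induction p using SymmetricAlgebra.induction with
  | algebraMap c => exact ⟨0, by simp⟩
  | ι v =>
    refine ⟨algebraMap ℂ _ (2 * form M (root i) v), ?_⟩
    have h : reflectionRep cs (cs.simple i) = simpleReflection M i :=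
      cs.lift_apply_simple (simpleReflection_isLiftable M) i
    rw [symAct_ι, h, simpleReflection, Module.preReflection_apply, map_sub, map_smul,
      sub_sub_cancel, mul_comm, ← Algebra.smul_def, symRoot]
    simp
  | mul a b ha hb =>
    obtain ⟨a', ha⟩ := ha
    obtain ⟨b', hb⟩ := hb
    refine ⟨a' * b + symAct (reflectionRep cs) (cs.simple i) a * b', ?_⟩
    rw [mul_add, ← mul_assoc, ha, mul_left_comm, hb, map_mul]
    ring
  | add a b ha hb =>
    obtain ⟨a', ha⟩ := ha
    obtain ⟨b', hb⟩ := hb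
    exact ⟨a' + b', by rw [mul_add, ha, hb, map_add]; ring⟩

/-- Demazure operators are linear over the invariants, so they preserve ideals generated by
invariants. -/
theorem mem_span_of_symRoot_mul_eq_sub {ι : Type*} {f : ι → SymmetricAlgebra ℂ (Fin n → ℂ)}
    (hf : ∀ j, f j ∈ invariants (reflectionRep cs)) {s : Set ι} {i : Fin n}
    {x y : SymmetricAlgebra ℂ (Fin n → ℂ)} (hx : x ∈ Ideal.span (f '' s))
    (hy : symRoot i * y = x - symAct (reflectionRep cs) (cs.simple i) x) :
    y ∈ Ideal.span (f '' s) := by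
  have key : ∀ x ∈ Ideal.span (f '' s), ∀ a y,
      symRoot i * y = a * x - symAct (reflectionRep cs) (cs.simple i) (a * x) →
      y ∈ Ideal.span (f '' s) := by
    intro x hx
    induction hx using Submodule.span_induction with
    | mem x hx =>
      obtain ⟨j, hj, rfl⟩ := hx
      intro a y h
      obtain ⟨q, hq⟩ := exists_symRoot_mul_eq_sub cs i a
      have : y = q * f j := by
        apply mul_left_cancel₀ (symRoot_ne_zero i)
        rw [h, map_mul, hf j, ← sub_mul, ← hq, mul_assoc]
      rw [this]
      exact Ideal.mul_mem_left _ _ (Ideal.subset_span ⟨j, hj, rfl⟩)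
    | zero =>
      intro a y h
      have : y = 0 := by
        apply mul_left_cancel₀ (symRoot_ne_zero i)
        rw [h]; simp
      rw [this]
      exact zero_mem _
    | add x₁ x₂ _ _ h₁ h₂ =>
      intro a y h
      obtain ⟨q₁, hq₁⟩ := exists_symRoot_mul_eq_sub cs i (a * x₁)
      obtain ⟨q₂, hq₂⟩ := exists_symRoot_mul_eq_sub cs i (a * x₂)
      have : y = q₁ + q₂ := by
        apply mul_left_cancel₀ (symRoot_ne_zero i)
        rw [h, mul_add, mul_add, hq₁, hq₂, map_add]
        ring
      rw [this]
      exact add_mem (h₁ a q₁ hq₁) (h₂ a q₂ hq₂)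
    | smul c x _ hx =>
      intro a y h
      rw [smul_eq_mul, ← mul_assoc] at h
      exact hx (a * c) y h
  exact key x hx 1 y (by rw [one_mul]; exact hy)

theorem mem_symDeg_of_symRoot_mul_mem {i : Fin n} {k : ℕ} {q : SymmetricAlgebra ℂ (Fin n → ℂ)}
    (hq : symRoot i * q ∈ symDeg (Fin n → ℂ) (1 + k)) : q ∈ symDeg (Fin n → ℂ) k := by
  have e := DirectSum.decompose_of_mem_same _ hq
  have hi : symRoot i ∈ symDeg (Fin n → ℂ) 1 := ι_mem_symDeg (root i)
  rw [DirectSum.coe_decompose_mul_add_of_left_mem _ hi] at e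
  rw [← mul_left_cancel₀ (symRoot_ne_zero i) e]
  exact SetLike.coe_mem _

theorem mem_range_aeval {f : Fin n → SymmetricAlgebra ℂ (Fin n → ℂ)}
    (hadj : Algebra.adjoin ℂ (Set.range f) = invariants (reflectionRep cs))
    {p : SymmetricAlgebra ℂ (Fin n → ℂ)} (hp : p ∈ invariants (reflectionRep cs)) :
    ∃ q : MvPolynomial (Fin n) ℂ, MvPolynomial.aeval f q = p := by
  rw [← hadj, Algebra.adjoin_range_eq_range_aeval] at hp
  exact hp

theorem aeval_mem_span {f : Fin n → SymmetricAlgebra ℂ (Fin n → ℂ)} {s : Set (Fin n)}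
    {q : MvPolynomial (Fin n) ℂ}
    (hq : q ∈ Ideal.span (MvPolynomial.X '' s : Set (MvPolynomial (Fin n) ℂ))) :
    MvPolynomial.aeval f q ∈ Ideal.span (f '' s) := by
  have h := Ideal.mem_map_of_mem (MvPolynomial.aeval f) hq
  rw [Ideal.map_span, Set.image_image] at h
  simpa using h

/-- Averaging sends an ideal of the symmetric algebra that is generated by some of the basic
invariants to the corresponding ideal of the algebra of invariants. -/
theorem exists_aeval_eq_sum_symAct [Fintype W] {f : Fin n → SymmetricAlgebra ℂ (Fin n → ℂ)}
    (hf : ∀ j, f j ∈ invariants (reflectionRep cs))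
    (hadj : Algebra.adjoin ℂ (Set.range f) = invariants (reflectionRep cs)) {s : Set (Fin n)}
    {x : SymmetricAlgebra ℂ (Fin n → ℂ)} (hx : x ∈ Ideal.span (f '' s)) :
    ∃ q ∈ Ideal.span (MvPolynomial.X '' s : Set (MvPolynomial (Fin n) ℂ)),
      MvPolynomial.aeval f q = ∑ w, symAct (reflectionRep cs) w x := by
  have key : ∀ x ∈ Ideal.span (f '' s), ∀ a,
      ∃ q ∈ Ideal.span (MvPolynomial.X '' s : Set (MvPolynomial (Fin n) ℂ)),
        MvPolynomial.aeval f q = ∑ w, symAct (reflectionRep cs) w (a * x) := by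
    intro x hx
    induction hx using Submodule.span_induction with
    | mem x hx =>
      obtain ⟨j, hj, rfl⟩ := hx
      intro a
      obtain ⟨q, hq⟩ := mem_range_aeval cs hadj (sum_symAct_mem_invariants (reflectionRep cs) a)
      refine ⟨q * MvPolynomial.X j, Ideal.mul_mem_left _ _ (Ideal.subset_span ⟨j, hj, rfl⟩), ?_⟩
      rw [map_mul, hq, MvPolynomial.aeval_X, Finset.sum_mul]
      exact Finset.sum_congr rfl fun w _ => by rw [map_mul, hf j w]
    | zero => exact fun a => ⟨0, zero_mem _, by simp⟩
    | add x₁ x₂ _ _ h₁ h₂ =>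
      intro a
      obtain ⟨q₁, hq₁, e₁⟩ := h₁ a
      obtain ⟨q₂, hq₂, e₂⟩ := h₂ a
      refine ⟨q₁ + q₂, add_mem hq₁ hq₂, ?_⟩
      simp only [map_add, e₁, e₂, mul_add, Finset.sum_add_distrib]
    | smul c x _ hx =>
      intro a
      simpa only [smul_eq_mul, mul_assoc] using hx (a * c)
  simpa using key x hx 1

/-- Basic invariants form a regular sequence in the symmetric algebra. Suppose that `p fᵢ` lies
in `J = (fⱼ : j ∈ s)`. By induction on the degree, `J` contains the Demazure derivatives of `p`,
so `p` agrees modulo `J` with its average over the group. The average is a polynomial in the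
basic invariants, where the assertion is clear. -/
theorem mem_span_of_mul_invariant_mem [Finite W] {f : Fin n → SymmetricAlgebra ℂ (Fin n → ℂ)}
    (hind : AlgebraicIndependent ℂ f)
    (hadj : Algebra.adjoin ℂ (Set.range f) = invariants (reflectionRep cs)) {s : Set (Fin n)}
    {i : Fin n} (hi : i ∉ s) (k : ℕ) {p : SymmetricAlgebra ℂ (Fin n → ℂ)}
    (hpk : p ∈ symDeg (Fin n → ℂ) k) (hp : p * f i ∈ Ideal.span (f '' s)) :
    p ∈ Ideal.span (f '' s) := by
  have := Fintype.ofFinite W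
  have hf : ∀ j, f j ∈ invariants (reflectionRep cs) := fun j => by
    rw [← hadj]
    exact Algebra.subset_adjoin ⟨j, rfl⟩
  induction k using Nat.strong_induction_on generalizing p with
  | _ k ih =>
    have hs : ∀ j, p - symAct (reflectionRep cs) (cs.simple j) p ∈ Ideal.span (f '' s) := by
      intro j
      rcases k with _ | k
      · obtain ⟨c, rfl⟩ := mem_symDeg_zero hpk
        simp
      · obtain ⟨q, hq⟩ := exists_symRoot_mul_eq_sub cs j p
        rw [← hq]
        refine Ideal.mul_mem_left _ _
          (ih k k.lt_succ_self (mem_symDeg_of_symRoot_mul_mem (i := j) ?_) ?_)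
        · rw [hq, add_comm]
          exact sub_mem hpk (symAct_mem _ _ _ _ hpk)
        · refine mem_span_of_symRoot_mul_eq_sub cs hf hp (i := j) ?_
          rw [← mul_assoc, hq, map_mul, hf i, sub_mul]
    have hw : ∀ w, p - symAct (reflectionRep cs) w p ∈ Ideal.span (f '' s) := by
      intro w
      induction w using cs.simple_induction_left with
      | one => simp [symAct_one]
      | mul_simple_left w j hw =>
        have h := span_image_le_comap (w := symAct (reflectionRep cs) (cs.simple j)) (f := f)
          (c := fun _ => 1) (fun l => by rw [hf l, one_smul]) s hw
        have e : p - symAct (reflectionRep cs) (cs.simple j * w) p =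
            (p - symAct (reflectionRep cs) (cs.simple j) p) +
              symAct (reflectionRep cs) (cs.simple j) (p - symAct (reflectionRep cs) w p) := by
          rw [symAct_mul, map_sub, AlgHom.comp_apply]
          ring
        rw [e]
        exact add_mem (hs j) h
    have hsum : ∑ w, symAct (reflectionRep cs) w p ∈ Ideal.span (f '' s) := by
      obtain ⟨q, hq⟩ := mem_range_aeval cs hadj (sum_symAct_mem_invariants (reflectionRep cs) p)
      obtain ⟨q', hq', e⟩ := exists_aeval_eq_sum_symAct cs hf hadj hp
      have hqq' : q * MvPolynomial.X i = q' := by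
        apply hind
        rw [map_mul, hq, e, MvPolynomial.aeval_X, Finset.sum_mul]
        exact Finset.sum_congr rfl fun w _ => by rw [map_mul, hf i w]
      rw [← hq]
      exact aeval_mem_span (mem_span_X_of_mul_X_mem hi (hqq' ▸ hq'))
    have hcard : (Fintype.card W : ℂ) • p ∈ Ideal.span (f '' s) := by
      have h := add_mem
        (Ideal.sum_mem (Ideal.span (f '' s)) fun w (_ : w ∈ Finset.univ) => hw w) hsum
      rw [Finset.sum_sub_distrib, sub_add_cancel, Finset.sum_const, Finset.card_univ] at h
      rwa [Nat.cast_smul_eq_nsmul]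
    have h0 : (Fintype.card W : ℂ) ≠ 0 := by exact_mod_cast Fintype.card_ne_zero
    rw [← inv_smul_smul₀ h0 p, Algebra.smul_def]
    exact Ideal.mul_mem_left _ _ hcard

theorem pos_of_algebraicIndependent {f : Fin n → SymmetricAlgebra ℂ (Fin n → ℂ)}
    (hind : AlgebraicIndependent ℂ f) {d : Fin n → ℕ}
    (hfd : ∀ i, f i ∈ symDeg (Fin n → ℂ) (d i)) (i : Fin n) : 0 < d i := by
  rw [Nat.pos_iff_ne_zero]
  intro h
  have h' := hfd i
  rw [h] at h'
  obtain ⟨c, hc⟩ := mem_symDeg_zero h'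
  exact hind.transcendental i (hc ▸ isAlgebraic_algebraMap c)

/-- The basic invariants generate the ideal of all homogeneous invariants of positive degree. -/
theorem coinvIdeal_eq_span {f : Fin n → SymmetricAlgebra ℂ (Fin n → ℂ)}
    (hind : AlgebraicIndependent ℂ f)
    (hadj : Algebra.adjoin ℂ (Set.range f) = invariants (reflectionRep cs)) {d : Fin n → ℕ}
    (hfd : ∀ i, f i ∈ symDeg (Fin n → ℂ) (d i)) :
    coinvIdeal (reflectionRep cs) = Ideal.span (f '' Set.univ) := by
  have hpos := pos_of_algebraicIndependent hind hfd
  apply le_antisymm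
  · rw [coinvIdeal, Ideal.span_le]
    rintro g ⟨hg, k, hk, hgk⟩
    obtain ⟨q, rfl⟩ := mem_range_aeval cs hadj hg
    have hq : q - MvPolynomial.C (MvPolynomial.coeff 0 q) ∈
        Ideal.span (MvPolynomial.X '' Set.univ : Set (MvPolynomial (Fin n) ℂ)) := by
      rw [MvPolynomial.mem_ideal_span_X_image]
      intro m hm
      by_contra! h
      have h0 : m = 0 := by
        ext i
        exact h i trivial
      rw [MvPolynomial.mem_support_iff, h0] at hm
      simp at hm
    have h1 := aeval_mem_span (f := f) hq
    have hle : Ideal.span (f '' Set.univ) ≤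
        RingHom.ker (SymmetricAlgebra.algebraMapInv (R := ℂ) (M := Fin n → ℂ)) := by
      rw [Ideal.span_le]
      rintro _ ⟨i, -, rfl⟩
      exact algebraMapInv_eq_zero (hpos i) (hfd i)
    -- the augmentation shows that the constant term vanishes
    have h2 := hle h1
    rw [RingHom.mem_ker, map_sub, map_sub, algebraMapInv_eq_zero hk hgk, MvPolynomial.aeval_C,
      AlgHom.commutes, zero_sub, neg_eq_zero] at h2
    rw [Algebra.algebraMap_self_apply] at h2
    rw [h2, map_zero, sub_zero] at h1
    exact h1
  · rw [Ideal.span_le]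
    rintro _ ⟨i, -, rfl⟩
    refine Ideal.subset_span ⟨?_, d i, hpos i, hfd i⟩
    rw [← hadj]
    exact Algebra.subset_adjoin ⟨i, rfl⟩

end Chevalley

/-! ### Molien series -/

section Molien

variable {n : ℕ}

/-- An endomorphism of finite order has an eigenbasis. -/
theorem exists_eigenbasis {T : Module.End ℂ (Fin n → ℂ)} {m : ℕ} (hm : 0 < m) (hT : T ^ m = 1) :
    ∃ (b : Module.Basis (Fin n) ℂ (Fin n → ℂ)) (μ : Fin n → ℂ), ∀ i, T (b i) = μ i • b i := by
  have hss : T.IsSemisimple := by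
    refine Module.End.isSemisimple_of_squarefree_aeval_eq_zero
      (p := (Polynomial.X ^ m - 1 : Polynomial ℂ)) ?_ (by simp [hT])
    exact (Polynomial.X_pow_sub_one_separable_iff.2 (by exact_mod_cast hm.ne')).squarefree
  have hspan : ⊤ ≤ Submodule.span ℂ {v | ∃ μ : ℂ, T v = μ • v} := by
    rw [← hss.iSup_eigenspace_eq_top]
    refine iSup_le fun μ v hv => Submodule.subset_span ⟨μ, Module.End.mem_eigenspace_iff.1 hv⟩
  let b := Module.Basis.ofSpan hspan
  have : Fintype _ := FiniteDimensional.fintypeBasisIndex b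
  have hcard := Module.finrank_eq_card_basis b
  rw [Module.finrank_fin_fun] at hcard
  have hb : ∀ i, ∃ μ : ℂ, T (b i) = μ • b i := fun i =>
    Module.Basis.ofSpan_subset hspan ⟨i, rfl⟩
  choose μ hμ using hb
  let e := Fintype.equivFinOfCardEq hcard.symm
  exact ⟨b.reindex e, fun i => μ (e.symm i), fun i => by simp [hμ]⟩

theorem toMatrix_eq_diagonal {T : Module.End ℂ (Fin n → ℂ)}
    {b : Module.Basis (Fin n) ℂ (Fin n → ℂ)} {μ : Fin n → ℂ} (h : ∀ i, T (b i) = μ i • b i) :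
    LinearMap.toMatrix b b T = Matrix.diagonal μ := by
  ext i j
  rw [LinearMap.toMatrix_apply, h, map_smul, b.repr_self, Finsupp.smul_apply, Matrix.diagonal_apply,
    Finsupp.single_apply, smul_eq_mul]
  by_cases hij : i = j
  · subst hij; simp
  · simp [hij, Ne.symm hij]

theorem charpoly_toMatrix'_eq_diagonal {T : Module.End ℂ (Fin n → ℂ)}
    {b : Module.Basis (Fin n) ℂ (Fin n → ℂ)} {μ : Fin n → ℂ} (h : ∀ i, T (b i) = μ i • b i) :
    (LinearMap.toMatrix' T).charpoly = (Matrix.diagonal μ).charpoly := by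
  rw [← toMatrix_eq_diagonal h, LinearMap.charpoly_toMatrix, ← LinearMap.toMatrix_eq_toMatrix',
    LinearMap.charpoly_toMatrix]

variable {M : CoxeterMatrix (Fin n)} {W : Type*} [Group W] (cs : CoxeterSystem M W)

theorem detOneSub_eq_prod {w : W} {b : Module.Basis (Fin n) ℂ (Fin n → ℂ)} {μ : Fin n → ℂ}
    (h : ∀ i, reflectionRep cs w (b i) = μ i • b i) :
    detOneSub cs w = ∏ i, (1 - PowerSeries.C (μ i) * PowerSeries.X) := by
  have e : (LinearMap.toMatrix' (reflectionRep cs w)).charpolyRev =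
      ∏ i, (1 - Polynomial.C (μ i) * Polynomial.X) := by
    rw [← Matrix.reverse_charpoly, charpoly_toMatrix'_eq_diagonal h, Matrix.reverse_charpoly,
      Matrix.charpolyRev]
    have : (1 : Matrix (Fin n) (Fin n) (Polynomial ℂ)) -
        (Polynomial.X : Polynomial ℂ) • (Matrix.diagonal μ).map Polynomial.C =
        Matrix.diagonal fun i => 1 - Polynomial.C (μ i) * Polynomial.X := by
      ext1 i j
      by_cases hij : i = j
      · subst hij; simp [Polynomial.X_mul_C]
      · simp [hij]
    rw [this, Matrix.det_diagonal]
  rw [detOneSub, e, ← Polynomial.coeToPowerSeries.ringHom_apply, map_prod]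
  refine Finset.prod_congr rfl fun i _ => ?_
  simp

theorem exists_eigenbasis_reflectionRep [Finite W] (w : W) :
    ∃ (b : Module.Basis (Fin n) ℂ (Fin n → ℂ)) (μ : Fin n → ℂ),
      (∀ i, reflectionRep cs w (b i) = μ i • b i) ∧ ∀ i, μ i ^ orderOf w = 1 := by
  obtain ⟨b, μ, h⟩ := exists_eigenbasis (T := reflectionRep cs w) (orderOf_pos w)
    (by rw [← map_pow, pow_orderOf_eq_one, map_one])
  refine ⟨b, μ, h, fun i => ?_⟩
  have hk : ∀ k : ℕ, reflectionRep cs (w ^ k) (b i) = μ i ^ k • b i := by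
    intro k
    induction k with
    | zero => simp
    | succ k ih =>
      rw [pow_succ, map_mul, Module.End.mul_apply, h, map_smul, ih, smul_smul, pow_succ']
  have h1 := hk (orderOf w)
  rw [pow_orderOf_eq_one, map_one, Module.End.one_apply] at h1
  have h2 : (μ i ^ orderOf w - 1) • b i = 0 := by rw [sub_smul, ← h1, one_smul, sub_self]
  exact sub_eq_zero.1 ((smul_eq_zero.1 h2).resolve_right (b.ne_zero i))

/-- The elements of `W` have real matrices in the basis of simple roots. -/
theorem conj_toMatrix'_reflectionRep (w : W) :
    (LinearMap.toMatrix' (reflectionRep cs w)).map (starRingEnd ℂ) =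
      LinearMap.toMatrix' (reflectionRep cs w) := by
  induction w using cs.simple_induction_left with
  | one =>
    rw [map_one, Module.End.one_eq_id, LinearMap.toMatrix'_id,
      Matrix.map_one _ (map_zero _) (map_one _)]
  | mul_simple_left w i hw =>
    rw [map_mul, LinearMap.toMatrix'_mul, Matrix.map_mul, hw]
    congr 1
    have h : reflectionRep cs (cs.simple i) = simpleReflection M i :=
      cs.lift_apply_simple (simpleReflection_isLiftable M) i
    rw [h]
    ext j k
    rw [Matrix.map_apply, LinearMap.toMatrix'_apply, simpleReflection]
    have hf : form M (root i) (Pi.single k 1) = -(Real.cos (Real.pi / M i k) : ℂ) := form_root M i k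
    simp only [Module.preReflection_apply, LinearMap.smul_apply, Pi.sub_apply, Pi.smul_apply, hf]
    simp only [root, Pi.single_apply, smul_eq_mul, map_sub, map_mul, map_neg, Complex.conj_ofReal,
      apply_ite (starRingEnd ℂ), map_one, map_zero, Complex.conj_ofNat]

/-- `det (1 - t w) = det (1 - t w⁻¹)`: the eigenvalues of `w` are roots of unity, so those of
`w⁻¹` are their conjugates, and `w` has a real matrix. -/
theorem detOneSub_inv [Finite W] (w : W) : detOneSub cs w⁻¹ = detOneSub cs w := by
  obtain ⟨b, μ, h, hμ⟩ := exists_eigenbasis_reflectionRep cs w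
  have hinv : ∀ i, reflectionRep cs w⁻¹ (b i) = (starRingEnd ℂ (μ i)) • b i := by
    intro i
    have hn : ‖μ i‖ = 1 := Complex.norm_eq_one_of_pow_eq_one (hμ i) (orderOf_pos w).ne'
    have h1 : starRingEnd ℂ (μ i) * μ i = 1 := by
      rw [mul_comm, Complex.mul_conj, Complex.normSq_eq_norm_sq, hn]; simp
    have h2 : b i = starRingEnd ℂ (μ i) • reflectionRep cs w (b i) := by
      rw [h, smul_smul, h1, one_smul]
    conv_lhs => rw [h2]
    rw [map_smul, ← Module.End.mul_apply, ← map_mul, inv_mul_cancel, map_one, Module.End.one_apply]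
  rw [detOneSub, detOneSub, ← Matrix.reverse_charpoly, ← Matrix.reverse_charpoly,
    ← conj_toMatrix'_reflectionRep cs w, Matrix.charpoly_map, charpoly_toMatrix'_eq_diagonal h,
    charpoly_toMatrix'_eq_diagonal hinv, ← Matrix.charpoly_map]
  congr 4
  ext i j
  by_cases hij : i = j
  · subst hij; simp
  · simp [hij]

theorem detOneSub_conj (u w : W) : detOneSub cs (u * w * u⁻¹) = detOneSub cs w := by
  have h : LinearMap.toMatrix' (reflectionRep cs u⁻¹) *
      LinearMap.toMatrix' (reflectionRep cs u) = 1 := by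
    rw [← LinearMap.toMatrix'_mul, ← map_mul, inv_mul_cancel, map_one, Module.End.one_eq_id,
      LinearMap.toMatrix'_id]
  rw [detOneSub, detOneSub, ← Matrix.reverse_charpoly, ← Matrix.reverse_charpoly,
    map_mul (reflectionRep cs), map_mul (reflectionRep cs), LinearMap.toMatrix'_mul,
    LinearMap.toMatrix'_mul, Matrix.charpoly_mul_comm, ← mul_assoc, h, one_mul]

theorem constantCoeff_detOneSub (w : W) : PowerSeries.constantCoeff (detOneSub cs w) = 1 := by
  have := Matrix.eval_charpolyRev (M := LinearMap.toMatrix' (reflectionRep cs w))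
  rw [← Polynomial.coeff_zero_eq_eval_zero] at this
  rw [detOneSub, Polynomial.constantCoeff_coe, this]

instance (k : ℕ) : FiniteDimensional ℂ (coinvDeg (reflectionRep cs) k) :=
  inferInstanceAs (FiniteDimensional ℂ ((symDeg (Fin n → ℂ) k).map
    (Ideal.Quotient.mkₐ ℂ (coinvIdeal (reflectionRep cs))).toLinearMap))

/-- The graded character of the coinvariant algebra. -/
theorem mk_trace_coinvRep_mul_detOneSub [Finite W] {d : Fin n → ℕ}
    (hd : IsDegrees (reflectionRep cs) d) (w : W) :
    PowerSeries.mk (fun k => LinearMap.trace ℂ _ (coinvRep (reflectionRep cs) k w)) *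
      detOneSub cs w = ∏ i, (1 - PowerSeries.X ^ d i) := by
  obtain ⟨f, hfd, hind, hadj⟩ := hd
  obtain ⟨b, μ, hb, -⟩ := exists_eigenbasis_reflectionRep cs w
  have hw := symAct_mem (reflectionRep cs) w
  have hf : ∀ i, symAct (reflectionRep cs) w (f i) = (1 : ℂ) • f i := fun i => by
    have : f i ∈ invariants (reflectionRep cs) := by
      rw [← hadj]
      exact Algebra.subset_adjoin ⟨i, rfl⟩
    rw [this w, one_smul]
  have h1 := mk_quotTrace_span_range (symDeg (Fin n → ℂ)) hw hfd hf fun i k p hpk hp =>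
    mem_span_of_mul_invariant_mem cs hind hadj (by simp) k hpk hp
  have h2 := prod_mul_mk_quotTrace_bot b hw (μ := μ) fun i => by rw [symAct_ι, hb, map_smul]
  have h3 : (fun k => LinearMap.trace ℂ _ (coinvRep (reflectionRep cs) k w)) =
      quotTrace (symDeg (Fin n → ℂ)) (Ideal.span (f '' Set.univ)) (symAct (reflectionRep cs) w)
        (span_image_le_comap hf _) hw := by
    funext k
    exact quotTrace_congr (symDeg (Fin n → ℂ)) (coinvIdeal_eq_span cs hind hadj hfd) _
      (coinvIdeal_le_comap (reflectionRep cs) w) _ hw k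
  rw [h3, h1, detOneSub_eq_prod cs hb, mul_assoc, mul_comm (PowerSeries.mk _), h2, mul_one]
  simp

end Molien

/-! ### Summation over even split classes -/

/-- If `φ : G → H` is onto, the elements that `φ` sends into the class of `h` number
`|G| / |C_h|`. -/
theorem card_filter_mk_mul_card_centralizer {G H : Type*} [Group G] [Group H] [Fintype G]
    [Finite H] [DecidableEq (ConjClasses H)] (φ : G →* H) (hφ : Function.Surjective φ) (h : H) :
    (Finset.univ.filter fun x : G => ConjClasses.mk (φ x) = ConjClasses.mk h).card *
      Nat.card (Subgroup.centralizer {h}) = Nat.card G := by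
  classical
  have := Fintype.ofFinite H
  have hfib : ∀ y : H, (Finset.univ.filter fun x : G => φ x = y).card =
      (Finset.univ.filter fun x : G => φ x = 1).card := fun y =>
    MonoidHom.card_fiber_eq_of_mem_range φ (hφ y) (hφ 1)
  have h1 : Fintype.card G =
      Fintype.card H * (Finset.univ.filter fun x : G => φ x = 1).card := by
    rw [← Finset.card_univ, Finset.card_eq_sum_card_fiberwise (f := φ) (t := Finset.univ)
      (fun _ _ => Finset.mem_coe.2 (Finset.mem_univ _)), Finset.sum_congr rfl fun y _ => hfib y,
      Finset.sum_const, smul_eq_mul, Finset.card_univ]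
  have h2 : (Finset.univ.filter fun x : G => ConjClasses.mk (φ x) = ConjClasses.mk h).card =
      Nat.card (ConjClasses.mk h).carrier * (Finset.univ.filter fun x : G => φ x = 1).card := by
    rw [Finset.card_eq_sum_card_fiberwise (f := φ) (t := (ConjClasses.mk h).carrier.toFinset)
      (fun x hx => by simpa [ConjClasses.mem_carrier_iff_mk_eq] using hx),
      Nat.card_eq_fintype_card, ← Set.toFinset_card, ← smul_eq_mul, ← Finset.sum_const]
    refine Finset.sum_congr rfl fun y hy => ?_
    rw [Set.mem_toFinset, ConjClasses.mem_carrier_iff_mk_eq] at hy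
    rw [← hfib y, Finset.filter_filter]
    congr 1
    ext x
    simp only [Finset.mem_filter, Finset.mem_univ, true_and, and_iff_right_iff_imp]
    rintro rfl
    exact hy
  have h3 : Nat.card (ConjClasses.mk h).carrier * Nat.card (Subgroup.centralizer {h}) =
      Nat.card H := by
    rw [← ConjAct.orbit_eq_carrier_conjClasses, Subgroup.nat_card_centralizer_nat_card_stabilizer]
    have := MulAction.card_orbit_mul_card_stabilizer_eq_card_group (ConjAct H) h
    simp only [← Nat.card_eq_fintype_card] at this
    exact this
  rw [h2, mul_right_comm, h3, Nat.card_eq_fintype_card, Nat.card_eq_fintype_card, h1]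

section

variable {n : ℕ} {M : CoxeterMatrix (Fin n)} {W : Type*} [Group W] (cs : CoxeterSystem M W)
  {U : Type*} [AddCommGroup U] [Module ℂ U]
  (S : SuperModule (CliffordAlgebra.evenOdd (quadForm M)) U)
  {E : Type*} [AddCommGroup E] [Module ℂ E] (χ : SuperModule (spinPart M) E)

/-- The value `χ(x) tr(x)|_B`, for the basic spin module `B`. -/
def spinProduct (x : Cover M) : ℂ := χ.character (toSpin x) * (basicSpin S).character (toSpin x)

theorem spinProduct_conj (u x : Cover M) : spinProduct S χ (u * x * u⁻¹) = spinProduct S χ x := by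
  simp only [spinProduct, character_conj]

theorem spinProduct_z_mul (x : Cover M) : spinProduct S χ (z M * x) = spinProduct S χ x := by
  simp only [spinProduct, character_z_mul, neg_mul_neg]

/-- A spin character vanishes at odd elements, and at elements `x` conjugate to `z x`. -/
theorem isEvenSplit_of_spinProduct_ne_zero {x : Cover M} (hx : spinProduct S χ x ≠ 0) :
    IsEvenSplit cs (ConjClasses.mk (θ cs x)) := by
  have hχ : χ.character (toSpin x) ≠ 0 := left_ne_zero_of_mul hx
  refine ⟨x, rfl, ?_, fun h => ?_⟩
  · rcases SuperModule.zmod_two_cases (Multiplicative.toAdd (parity M x)) with h | h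
    · exact h
    · exact absurd (χ.character_odd (Submodule.subset_span ⟨x, h, rfl⟩)) hχ
  · obtain ⟨u, hu⟩ := isConj_iff.1 h
    have h' := character_conj χ u x
    rw [hu, character_z_mul] at h'
    exact hχ (self_eq_neg.1 h'.symm)

theorem spinProduct_eq_of_mk_eq {x y : Cover M}
    (h : ConjClasses.mk (θ cs x) = ConjClasses.mk (θ cs y)) :
    spinProduct S χ x = spinProduct S χ y := by
  obtain ⟨c, hc⟩ := isConj_iff.1 (ConjClasses.mk_eq_mk_iff_isConj.1 h)
  obtain ⟨u, rfl⟩ := θ_surjective cs c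
  rw [← map_inv, ← map_mul, ← map_mul] at hc
  rw [← spinProduct_conj S χ u x]
  rcases eq_or_eq_z_mul cs hc with h | h
  · rw [h]
  · rw [h, spinProduct_z_mul]

theorem detOneSub_eq_of_mk_eq {v w : W} (h : ConjClasses.mk v = ConjClasses.mk w) :
    detOneSub cs v = detOneSub cs w := by
  obtain ⟨c, rfl⟩ := isConj_iff.1 (ConjClasses.mk_eq_mk_iff_isConj.1 h)
  exact (detOneSub_conj cs c v).symm

theorem mk_trace_coinvRep [Finite W] {d : Fin n → ℕ} (hd : IsDegrees (reflectionRep cs) d) (w : W) :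
    PowerSeries.mk (fun k => LinearMap.trace ℂ _ (coinvRep (reflectionRep cs) k w)) =
      (∏ i, (1 - PowerSeries.X ^ d i)) * (detOneSub cs w)⁻¹ := by
  rw [PowerSeries.eq_mul_inv_iff_mul_eq (by rw [constantCoeff_detOneSub]; exact one_ne_zero)]
  exact mk_trace_coinvRep_mul_detOneSub cs hd w

/-- The spin fake degree as an average over `W̃`. -/
theorem spinFakeDegree_eq_sum [Finite W] [Fintype (Cover M)] [FiniteDimensional ℂ U]
    [FiniteDimensional ℂ E] {d : Fin n → ℕ} (hd : IsDegrees (reflectionRep cs) d) :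
    spinFakeDegree cs S χ = PowerSeries.C (Nat.card (Cover M) : ℂ)⁻¹ *
      ∑ x, PowerSeries.C (spinProduct S χ x) *
        ((∏ i, (1 - PowerSeries.X ^ d i)) * (detOneSub cs (θ cs x))⁻¹) := by
  ext k
  rw [spinFakeDegree, PowerSeries.coeff_mk, finrank_hom_eq_sum, PowerSeries.coeff_C_mul, map_sum]
  congr 1
  refine Finset.sum_congr rfl fun x _ => ?_
  rw [tensorRep_character, basicSpin_character_inv, PowerSeries.coeff_C_mul, map_inv, ← mul_assoc,
    ← detOneSub_inv, ← mk_trace_coinvRep cs hd, PowerSeries.coeff_mk]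
  rfl

theorem molienTerm_eq (x : Cover M) [Finite W] :
    PowerSeries.C (Nat.card (Subgroup.centralizer {θ cs x}) : ℂ) * molienTerm cs S χ x =
      PowerSeries.C (spinProduct S χ x) * (detOneSub cs (θ cs x))⁻¹ := by
  have h0 : (Nat.card (Subgroup.centralizer {θ cs x}) : ℂ) ≠ 0 := by
    exact_mod_cast Nat.card_pos.ne'
  have h1 : (PowerSeries.C (Nat.card (Subgroup.centralizer {θ cs x}) : ℂ) : PowerSeries ℂ) *
      (PowerSeries.C (Nat.card (Subgroup.centralizer {θ cs x}) : ℂ))⁻¹ = 1 :=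
    PowerSeries.mul_inv_cancel _ (by simpa using h0)
  have e : (Nat.card (Subgroup.centralizer {θ cs x}) : PowerSeries ℂ) =
      PowerSeries.C (Nat.card (Subgroup.centralizer {θ cs x}) : ℂ) := (map_natCast _ _).symm
  rw [molienTerm, e, PowerSeries.mul_inv_rev, spinProduct]
  linear_combination (PowerSeries.C (χ.character (toSpin x) * (basicSpin S).character (toSpin x)) *
    (detOneSub cs (θ cs x))⁻¹) * h1

end

end SpinWeyl

end

theorem corollary3p3 {n : ℕ} (M : CoxeterMatrix (Fin n)) (hM : SpinWeyl.IsCrystallographic M)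
    {W : Type*} [Group W] [Finite W] (cs : CoxeterSystem M W)
    (d : Fin n → ℕ) (hd : SpinWeyl.IsDegrees (SpinWeyl.reflectionRep cs) d)
    {U : Type*} [AddCommGroup U] [Module ℂ U] [FiniteDimensional ℂ U]
    (S : SpinWeyl.SuperModule (CliffordAlgebra.evenOdd (SpinWeyl.quadForm M)) U)
    (hS : S.IsSimple)
    {E : Type*} [AddCommGroup E] [Module ℂ E] [FiniteDimensional ℂ E]
    (χ : SpinWeyl.SuperModule (SpinWeyl.spinPart M) E) (hχ : χ.IsSimple)
    (lift : ConjClasses W → SpinWeyl.Cover M)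
    (hlift : ∀ C, SpinWeyl.IsEvenSplit cs C → ConjClasses.mk (SpinWeyl.θ cs (lift C)) = C) :
    SpinWeyl.spinFakeDegree cs S χ =
      (∑ᶠ C ∈ {C : ConjClasses W | SpinWeyl.IsEvenSplit cs C},
        SpinWeyl.molienTerm cs S χ (lift C)) *
      ∏ i, (1 - PowerSeries.X ^ d i) := by
  classical
  have : Finite (SpinWeyl.Cover M) := SpinWeyl.finite_cover cs
  have := Fintype.ofFinite (SpinWeyl.Cover M)
  have := Fintype.ofFinite (ConjClasses W)
  have hG : (Nat.card (SpinWeyl.Cover M) : ℂ) ≠ 0 := by exact_mod_cast Nat.card_pos.ne'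
  rw [SpinWeyl.spinFakeDegree_eq_sum cs S χ hd, finsum_mem_eq_toFinset_sum, Finset.sum_mul,
    ← Finset.sum_fiberwise Finset.univ (fun x => ConjClasses.mk (SpinWeyl.θ cs x)),
    Finset.mul_sum, eq_comm]
  refine Finset.sum_subset_zero_on_sdiff (Finset.subset_univ _) (fun C hC => ?_) fun C hC => ?_
  · -- classes that are not even split do not contribute
    rw [Finset.sum_eq_zero, mul_zero]
    intro x hx
    rw [(Finset.mem_filter.1 hx).2.symm] at hC
    have h0 : SpinWeyl.spinProduct S χ x = 0 := by
      by_contra h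
      exact (Finset.mem_sdiff.1 hC).2
        (Set.mem_toFinset.2 (SpinWeyl.isEvenSplit_of_spinProduct_ne_zero cs S χ h))
    rw [h0, map_zero, zero_mul]
  · have hC' := hlift C (by simpa using hC)
    have hconst : ∀ x ∈ Finset.univ.filter (fun x => ConjClasses.mk (SpinWeyl.θ cs x) = C),
        PowerSeries.C (SpinWeyl.spinProduct S χ x) *
          ((∏ i, (1 - PowerSeries.X ^ d i)) * (SpinWeyl.detOneSub cs (SpinWeyl.θ cs x))⁻¹) =
        PowerSeries.C (Nat.card (Subgroup.centralizer {SpinWeyl.θ cs (lift C)}) : ℂ) *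
          SpinWeyl.molienTerm cs S χ (lift C) * ∏ i, (1 - PowerSeries.X ^ d i) := by
      intro x hx
      have hx' := (Finset.mem_filter.1 hx).2.trans hC'.symm
      rw [SpinWeyl.molienTerm_eq, SpinWeyl.spinProduct_eq_of_mk_eq cs S χ hx',
        SpinWeyl.detOneSub_eq_of_mk_eq cs hx']
      ring
    have hcard := SpinWeyl.card_filter_mk_mul_card_centralizer (SpinWeyl.θ cs)
      (SpinWeyl.θ_surjective cs) (SpinWeyl.θ cs (lift C))
    rw [hC'] at hcard
    rw [Finset.sum_congr rfl hconst, Finset.sum_const, nsmul_eq_mul, ← map_natCast PowerSeries.C,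
      ← mul_assoc, ← mul_assoc, ← mul_assoc, ← map_mul, ← map_mul, mul_assoc _⁻¹, ← Nat.cast_mul,
      hcard, inv_mul_cancel₀ hG, map_one, one_mul]
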